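/- **Setting.** Let $Q$ and $U_0,\dots,U_{n-1}$ be finite-dimensional smooth (Hausdorff, boundaryless) Riemannian manifolds, with the product metric on $Q\times U_i$. Let $\mathbb U_i\subseteq U_i$ be closed, and let $F_i:Q\times U_i\to Q$, $\ell:Q\to\mathbb R$ and $L_i:Q\times U_i\to\mathbb R$ be $C^1$. Fix $q_0\in Q$. A control sequence $\mathbf u=(u_i)_{i=0}^{n-1}$ with $u_i\in\mathbb U_i$ generates states $q_{i+1}=F_i(q_i,u_i)$ and has cost $J(\mathbf u)=\ell(q_n)+\sum_{i=0}^{n-1}L_i(q_i,u_i)$. Let $\varphi_i:Q\times U_i\to[0,\infty)$ $(1\le i\le n-1)$ and $\varphi_n:Q\to[0,\infty)$ be locally Lipschitz. **Nonsmooth notions.** For $f:M\to\mathbb R\cup\{\infty\}$ on a manifold $M$, a Fréchet subgradient of $f$ at a point $x$ with $f(x)<\infty$ is a covector $dg(x)$, where $g:M\to\mathbb R$ is $C^1$ and $f-g$ has a local minimum at $x$. The limiting subdifferential $\partial_Lf(x)$ consists of the limits in $T^*M$ of Fréchet subgradients $p_k$ at points $x_k\to x$ with $f(x_k)\to f(x)$.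 For closed $S\subseteq M$ and $s\in S$ let $N^L_S(s)=\partial_L\chi_S(s)$, where $\chi_S=0$ on $S$ and $\chi_S=\infty$ off $S$, and let $T^C_S(s)=\{v\in T_sM:\langle p,v\rangle\le0\ \forall p\in N^L_S(s)\}$. A closed set $S$ is Clarke regular if for all $s\in S$, $v\in T^C_S(s)$ and $s_k\to s$ in $S$ there are $v_k\in T^C_S(s_k)$ with $v_k\to v$. For $\varphi:M\to[0,\infty)$, the constraint $\varphi=0$ is $\varphi$-regular at $x_0$ if (i) there is $\Delta>0$ such that $\|p\|\ge\Delta$ for all $x$ near $x_0$ with $\varphi(x)>0$ and all $p\in\partial_L\varphi(x)$; and (ii) whenever $x_k\to x_0$ and $p_k\in\partial_L\varphi(x_k)$, some subsequence of $(p_k)$ converges to an element of $\partial_L\varphi(x_0)$. **Theorem.** Suppose that $\mathbf u$, with states $\mathbf q$, minimizes $J$ over all control sequences (with $u_i\in\mathbb U_i$) that satisfy $\varphi_i(q_i,u_i)=0$ $(1\le i\le n-1)$ and $\varphi_n(q_n)=0$. Suppose that every $\mathbb U_i$ is Clarke regular, that the constraints $\varphi_i=0$ are $\varphi_i$-regular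 at $(q_i,u_i)$ $(1\le i\le n-1)$, and that $\varphi_n=0$ is $\varphi_n$-regular at $q_n$. Then there are $\lambda_0\in\{0,1\}$, a number $\kappa>0$ with $\kappa=1$ if $\lambda_0=0$, and covectors $a_i\in T^*_{q_i}Q$ $(1\le i\le n)$ and $b_i\in T^*_{u_i}U_i$ $(0\le i\le n-1)$ with $$b_0=0,\qquad (a_i,b_i)\in\partial_L\varphi_i(q_i,u_i)\ (1\le i\le n-1),\qquad a_n\in\partial_L\varphi_n(q_n),$$ such that the costates $p_i\in T^*_{q_i}Q$ $(1\le i\le n)$ defined by $$p_n=-\kappa a_n-\lambda_0\,d\ell(q_n),\qquad p_i=-\lambda_0\,d_qL_i(q_i,u_i)-\kappa a_i+D_qF_i(q_i,u_i)^*p_{i+1}\quad(1\le i\le n-1)$$ satisfy, for all $0\le i\le n-1$ and all $v\in T^C_{\mathbb U_i}(u_i)$, $$0\le\big\langle\lambda_0\,d_uL_i(q_i,u_i)+\kappa b_i-D_uF_i(q_i,u_i)^*p_{i+1},\,v\big\rangle .$$ Moreover, either $\lambda_0=1$ or $\mathbf a=(a_i)_{i=1}^n$ and $\mathbf b=(b_i)_{i=0}^{n-1}$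 are not both identically zero. -/

import Mathlib

open Set Filter Topology Bundle
open scoped Manifold ContDiff

section Nonsmooth

variable {E : Type*} [NormedAddCommGroup E] [NormedSpace ℝ E]
  {H : Type*} [TopologicalSpace H] (I : ModelWithCorners ℝ E H)
  {M : Type*} [TopologicalSpace M] [ChartedSpace H M]

/-- Covectors at the point `x` of `M`. -/
abbrev Covector (x : M) : Type _ := TangentSpace I x →L[ℝ] ℝ

/-- The differential `df(x)` of a real-valued function on `M`. -/
noncomputable def differential (f : M → ℝ) (x : M) : Covector I x :=
  mfderiv I 𝓘(ℝ, ℝ) f x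

/-- `f : M → ℝ` is locally Lipschitz: around every point there is a smooth chart in which `f` is
Lipschitz. (Restrictions of charts to smaller open sets belong to the maximal atlas.) -/
def LocallyLipschitzInCharts (f : M → ℝ) : Prop :=
  ∀ x : M, ∃ e ∈ IsManifold.maximalAtlas I ∞ M, x ∈ e.source ∧
    ∃ K, LipschitzOnWith K (f ∘ (e.extend I).symm) (e.extend I).target

/-- The Fréchet subdifferential of `f : M → ℝ ∪ {∞}` at `x`: differentials at `x` of `C¹` functions
`g : M → ℝ` such that `f - g` has a local minimum at `x`. -/
def frechetSubdifferential (f : M → EReal) (x : M) : Set (Covector I x) :=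
  {p | f x ≠ ⊤ ∧ ∃ g : M → ℝ, ContMDiff I 𝓘(ℝ, ℝ) 1 g ∧
    p = differential I g x ∧ IsLocalMin (fun y => f y - (g y : EReal)) x}

variable [IsManifold I ∞ M]

/-- Convergence `pₖ → p` of covectors with base points `xₖ`, `x`, in the cotangent bundle. -/
def CovectorTendsto (xs : ℕ → M) (ps : ∀ k, Covector I (xs k)) (x : M) (p : Covector I x) :
    Prop :=
  Tendsto
    (fun k => (⟨xs k, ps k⟩ : TotalSpace (E →L[ℝ] ℝ)
      (fun y : M => TangentSpace I y →L[ℝ] Bundle.Trivial M ℝ y)))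
    atTop (𝓝 ⟨x, p⟩)

/-- The limiting subdifferential of `f : M → ℝ ∪ {∞}` at `x`. -/
def limitingSubdifferential (f : M → EReal) (x : M) : Set (Covector I x) :=
  {p | ∃ (xs : ℕ → M) (ps : ∀ k, Covector I (xs k)),
    Tendsto xs atTop (𝓝 x) ∧ (∀ k, ps k ∈ frechetSubdifferential I f (xs k)) ∧
    Tendsto (fun k => f (xs k)) atTop (𝓝 (f x)) ∧ CovectorTendsto I xs ps x p}

/-- The limiting subdifferential of a real-valued function. -/
def limitingSubdifferentialReal (f : M → ℝ) (x : M) : Set (Covector I x) :=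
  limitingSubdifferential I (fun y => (f y : EReal)) x

/-- The function that is `0` on `S` and `∞` off `S`. -/
noncomputable def indicatorInfty (S : Set M) : M → EReal :=
  Set.indicator Sᶜ (fun _ => ⊤)

/-- The limiting normal cone to `S` at `x ∈ S`. -/
def limitingNormalCone (S : Set M) (x : M) : Set (Covector I x) :=
  limitingSubdifferential I (indicatorInfty S) x

/-- The Clarke tangent cone to `S` at `x ∈ S`, the polar of the limiting normal cone. -/
def clarkeTangentCone (S : Set M) (x : M) : Set (TangentSpace I x) :=
  {v | ∀ p ∈ limitingNormalCone I S x, p v ≤ 0}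

/-- Clarke regularity of a closed set `S`: Clarke tangent vectors at `s` are limits of Clarke
tangent vectors along every sequence in `S` which converges to `s`. -/
def IsClarkeRegular (S : Set M) : Prop :=
  IsClosed S ∧ ∀ s ∈ S, ∀ v ∈ clarkeTangentCone I S s, ∀ ss : ℕ → M, (∀ k, ss k ∈ S) →
    Tendsto ss atTop (𝓝 s) →
    ∃ vs : ∀ k, TangentSpace I (ss k), (∀ k, vs k ∈ clarkeTangentCone I S (ss k)) ∧
      Tendsto (fun k => (⟨ss k, vs k⟩ : TangentBundle I M)) atTop (𝓝 ⟨s, v⟩)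

/-- The norm of a covector dual to the norm on the tangent space whose square is `N`. -/
noncomputable def covectorNorm {x : M} (N : TangentSpace I x → ℝ) (p : Covector I x) : ℝ :=
  sSup {r : ℝ | ∃ v : TangentSpace I x, N v ≤ 1 ∧ r = p v}

/-- `φ`-regularity at `x₀` of the set `{x | φ x = 0}`, which does not depend on a parameter. Here
`N x v` is the squared length of the tangent vector `v` at `x` in the Riemannian metric of `M`. -/
def IsPhiRegularAt (N : ∀ x : M, TangentSpace I x → ℝ) (φ : M → ℝ) (x₀ : M) : Prop :=
  (∃ Δ : ℝ, 0 < Δ ∧ ∀ᶠ x in 𝓝 x₀, 0 < φ x →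
    ∀ p ∈ limitingSubdifferentialReal I φ x, Δ ≤ covectorNorm I (N x) p) ∧
  (∀ (xs : ℕ → M) (ps : ∀ k, Covector I (xs k)), Tendsto xs atTop (𝓝 x₀) →
    (∀ k, ps k ∈ limitingSubdifferentialReal I φ (xs k)) →
    ∃ σ : ℕ → ℕ, StrictMono σ ∧ ∃ p ∈ limitingSubdifferentialReal I φ x₀,
      CovectorTendsto I (fun j => xs (σ j)) (fun j => ps (σ j)) x₀ p)

end Nonsmooth

section Products

variable {E : Type*} [NormedAddCommGroup E] [NormedSpace ℝ E]
  {Q : Type*} [TopologicalSpace Q] [ChartedSpace E Q] [IsManifold 𝓘(ℝ, E) ∞ Q]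
  {F : Type*} [NormedAddCommGroup F] [NormedSpace ℝ F]
  {U : Type*} [TopologicalSpace U] [ChartedSpace F U] [IsManifold 𝓘(ℝ, F) ∞ U]

/-- A smooth Riemannian metric on `Q`. -/
abbrev RiemMetric (E : Type*) [NormedAddCommGroup E] [NormedSpace ℝ E]
    (Q : Type*) [TopologicalSpace Q] [ChartedSpace E Q] [IsManifold 𝓘(ℝ, E) ∞ Q] : Type _ :=
  ContMDiffRiemannianMetric 𝓘(ℝ, E) ∞ E (TangentSpace 𝓘(ℝ, E) : Q → Type _)

/-- The squared length of tangent vectors. -/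
noncomputable def RiemSq (g : RiemMetric E Q) (x : Q) (v : TangentSpace 𝓘(ℝ, E) x) : ℝ := g.inner x v v

/-- The squared length of tangent vectors to `Q × U` in the product metric. -/
noncomputable def RiemSqProd (g : RiemMetric E Q) (h : RiemMetric F U) (x : Q × U)
    (v : TangentSpace (𝓘(ℝ, E).prod 𝓘(ℝ, F)) x) : ℝ :=
  RiemSq g x.1 (Prod.fst (α := E) (β := F) v) + RiemSq h x.2 (Prod.snd (α := E) (β := F) v)

/-- The covector `(a, b)` on `Q × U` at `(q, u)`. -/
def covectorPair {q : Q} {u : U} (a : Covector 𝓘(ℝ, E) q) (b : Covector 𝓘(ℝ, F) u) :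
    Covector (𝓘(ℝ, E).prod 𝓘(ℝ, F)) (q, u) :=
  (ContinuousLinearMap.coprod (M₁ := E) (M₂ := F) a b : E × F →L[ℝ] ℝ)

end Products

section ControlSystem

variable {n : ℕ} {Q : Type*} {U : Fin n → Type*}

/-- The state sequence `q₀, …, qₙ` with `qᵢ₊₁ = Fᵢ (qᵢ, uᵢ)`. -/
def stateSeq (F : ∀ i, Q × U i → Q) (q₀ : Q) (u : ∀ i, U i) : Fin (n + 1) → Q :=
  Fin.induction q₀ (fun i q => F i (q, u i))

/-- The cost `J(u) = ℓ(qₙ) + ∑ Lᵢ(qᵢ, uᵢ)`. -/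
def cost (F : ∀ i, Q × U i → Q) (q₀ : Q) (ℓ : Q → ℝ) (L : ∀ i, Q × U i → ℝ) (u : ∀ i, U i) : ℝ :=
  ℓ (stateSeq F q₀ u (Fin.last n)) + ∑ i : Fin n, L i (stateSeq F q₀ u i.castSucc, u i)

/-- Control sequences `uᵢ ∈ Ωᵢ` which satisfy, together with their state sequence, the mixed
constraints `φᵢ(qᵢ, uᵢ) = 0` for `1 ≤ i ≤ n - 1` and the endpoint constraint `ψ(qₙ) = 0`. -/
def admissibleControls (F : ∀ i, Q × U i → Q) (q₀ : Q) (Ω : ∀ i, Set (U i))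
    (φ : ∀ i, Q × U i → ℝ) (ψ : Q → ℝ) : Set (∀ i, U i) :=
  {u | (∀ i, u i ∈ Ω i) ∧ (∀ i : Fin n, 0 < (i : ℕ) → φ i (stateSeq F q₀ u i.castSucc, u i) = 0) ∧
    ψ (stateSeq F q₀ u (Fin.last n)) = 0}

end ControlSystem

/-! ### Exact penalisation on compact sets. -/

section Penalty

/-! Written in charts around the optimal controls and states, the problem is to minimize a `C¹`
function `J` of the control coordinates over a locally closed product set `Ω`, subject to `Φ (G c) =
0`. Here `G` maps controls to trajectories and is `C¹` at the optimum; `Φ` is the sum of all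
constraints and is Lipschitz near the optimal trajectory.

A quadratic term makes the optimum the only minimizer on a compact neighbourhood, and minimizers
with penalty `N * Φ ∘ G` tend to it as `N` grows (`IsCompact.exists_penalized_minimizers`). If one
of them is the optimum itself, the penalty is exact: `λ₀ = 1`, `κ = N`. Otherwise division by `N`
gives `λ₀ = 0`, `κ = 1`, and every minimizer violates the constraint.

Since `Φ` is not smooth, `G x` is replaced by a free variable `z` at a quadratic cost
(`exists_frechet_stationary_near`). Minimality in `z` gives a Fréchet subgradient of `Φ`, minimality
in `x` a Fréchet normal to `Ω`, and the two are linked by the derivative of `G`. The Lipschitz bound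
makes the subgradients converge along a subsequence (`exists_multiplier_sequences`).

Because `Φ` is separable and `Ω` is a product, the limits split into the covectors `(aᵢ, bᵢ)`, `aₙ`
and one limiting normal for each control. Summation by parts (`adjoint_identity`) eliminates the
linearised states in favour of the costates. If `λ₀ = 0`, some single constraint is positive at
infinitely many of the approximating points; regularity keeps its subgradients there away from zero,
so its limiting multiplier does not vanish (`ne_zero_of_isPhiRegularAt`). -/

/-- Exact localisation of penalised sublevel sets on a compact set. -/
lemma IsCompact.exists_penalty_localizes {X : Type*} [TopologicalSpace X] {s : Set X}
    (hs : IsCompact s) {f g : X → ℝ} (hf : ContinuousOn f s) (hg : ContinuousOn g s)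
    (hg0 : ∀ x ∈ s, 0 ≤ g x) {x₀ : X}
    (huniq : ∀ x ∈ s, g x = 0 → f x ≤ f x₀ → x = x₀) {W : Set X} (hW : W ∈ 𝓝 x₀) :
    ∃ N₀ : ℝ, ∀ N, N₀ ≤ N → ∀ x ∈ s, f x + N * g x ≤ f x₀ → x ∈ W := by
  have hs' : IsCompact (s \ interior W) := hs.diff isOpen_interior
  have key : ∃ N₀ : ℝ, ∀ N, N₀ ≤ N → ∀ x ∈ (s \ interior W) ∩ s, f x₀ < f x + N * g x := by
    -- Each point away from `x₀` has a neighbourhood with its own threshold; as `g ≥ 0`, larger `N`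
    -- also works, so the maximum of finitely many thresholds suffices.
    refine hs'.induction_on (p := fun t => ∃ N₀ : ℝ, ∀ N, N₀ ≤ N → ∀ x ∈ t ∩ s,
      f x₀ < f x + N * g x) ⟨0, by simp⟩ ?_ ?_ ?_
    · rintro t t' h ⟨N₀, h'⟩
      exact ⟨N₀, fun N hN x hx => h' N hN x ⟨h hx.1, hx.2⟩⟩
    · rintro t t' ⟨N₀, h⟩ ⟨N₁, h'⟩
      refine ⟨max N₀ N₁, fun N hN x hx => ?_⟩
      rcases hx.1 with h1 | h1
      · exact h N ((le_max_left _ _).trans hN) x ⟨h1, hx.2⟩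
      · exact h' N ((le_max_right _ _).trans hN) x ⟨h1, hx.2⟩
    · intro x hx
      have hx0 : x ≠ x₀ := by
        rintro rfl
        exact hx.2 (mem_interior_iff_mem_nhds.2 hW)
      obtain ⟨N₀, hN₀⟩ : ∃ N₀ : ℝ, f x₀ < f x + N₀ * g x := by
        rcases (hg0 x hx.1).eq_or_lt with h | h
        · refine ⟨0, ?_⟩
          by_contra! h'
          exact hx0 (huniq x hx.1 h.symm (by linarith))
        · refine ⟨(f x₀ - f x + 1) / g x, ?_⟩
          rw [div_mul_cancel₀ _ h.ne']
          linarith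
      have hcont : ContinuousWithinAt (fun y => f y + N₀ * g y) s x :=
        (hf x hx.1).add (continuousWithinAt_const.mul (hg x hx.1))
      have hev : ∀ᶠ y in 𝓝[s] x, f x₀ < f y + N₀ * g y := hcont.eventually_const_lt hN₀
      refine ⟨{y | y ∈ s → f x₀ < f y + N₀ * g y}, ?_, N₀, ?_⟩
      · exact nhdsWithin_le_nhds (eventually_nhdsWithin_iff.1 hev)
      · rintro N hN y ⟨hy, hys⟩
        have := mul_le_mul_of_nonneg_right hN (hg0 y hys)
        linarith [hy hys]
  obtain ⟨N₀, h⟩ := key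
  refine ⟨N₀, fun N hN x hx hle => ?_⟩
  by_contra hxW
  exact absurd hle (not_le.2 (h N hN x ⟨⟨hx, fun h' => hxW (interior_subset h')⟩, hx⟩))

end Penalty

/-! ### A smooth quadratic perturbation. -/

section EuclideanSquare

variable {V : Type*} [NormedAddCommGroup V] [NormedSpace ℝ V] [FiniteDimensional ℝ V]

/-- The square of an auxiliary Euclidean norm on a finite-dimensional space. -/
noncomputable def euclSq (v : V) : ℝ := ‖toEuclidean v‖ ^ 2

/-- The given norm of `V` need not be differentiable away from `0`; this is why all quadratic terms
use an auxiliary Euclidean norm. -/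
lemma contDiff_euclSq : ContDiff ℝ 1 (euclSq : V → ℝ) :=
  (toEuclidean (E := V)).contDiff.norm_sq ℝ

@[simp] lemma euclSq_zero : euclSq (0 : V) = 0 := by simp [euclSq]

lemma euclSq_nonneg (v : V) : 0 ≤ euclSq v := sq_nonneg _

lemma eq_zero_of_euclSq_le_zero {v : V} (h : euclSq v ≤ 0) : v = 0 := by
  have : euclSq v = 0 := le_antisymm h (euclSq_nonneg v)
  simpa [euclSq] using this

lemma fderiv_euclSq_zero : fderiv ℝ (euclSq : V → ℝ) 0 = 0 :=
  IsLocalMin.fderiv_eq_zero (Eventually.of_forall fun v => by simpa using euclSq_nonneg v)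

lemma hasFDerivAt_euclSq (v : V) : HasFDerivAt (euclSq : V → ℝ) (fderiv ℝ euclSq v) v :=
  (contDiff_euclSq.differentiable one_ne_zero v).hasFDerivAt

lemma HasFDerivAt.euclSq {W : Type*} [NormedAddCommGroup W] [NormedSpace ℝ W] {h : W → V}
    {h' : W →L[ℝ] V} {x : W} (hh : HasFDerivAt h h' x) :
    HasFDerivAt (fun y => _root_.euclSq (h y)) ((fderiv ℝ _root_.euclSq (h x)).comp h') x :=
  (hasFDerivAt_euclSq (h x)).comp x hh

lemma continuous_fderiv_euclSq : Continuous (fderiv ℝ (euclSq : V → ℝ)) :=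
  contDiff_euclSq.continuous_fderiv one_ne_zero

end EuclideanSquare

/-! ### Fréchet subgradients and normals in vector spaces. -/

section FrechetVector

variable {V : Type*} [NormedAddCommGroup V] [NormedSpace ℝ V]
  {Z : Type*} [NormedAddCommGroup Z] [NormedSpace ℝ Z]

/-- `A` is a Fréchet subgradient of `f` at `z`. -/
def IsFrechetSubgradient (f : Z → ℝ) (z : Z) (A : Z →L[ℝ] ℝ) : Prop :=
  ∃ g : Z → ℝ, ContDiffAt ℝ 1 g z ∧ HasFDerivAt g A z ∧ IsLocalMin (fun y => f y - g y) z

/-- `B` is a Fréchet normal to `S` at `c`. -/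
def IsFrechetNormal (S : Set V) (c : V) (B : V →L[ℝ] ℝ) : Prop :=
  c ∈ S ∧ ∃ s : V → ℝ, ContDiffAt ℝ 1 s c ∧ HasFDerivAt s B c ∧ IsLocalMaxOn s S c

/-- Along a ray from `z`, the increments of `g` are at most those of `f`, hence at most `K * t *
‖v‖`; the slope at `t = 0` and the sign change `v ↦ -v` give the bound. -/
lemma IsFrechetSubgradient.norm_le {f : Z → ℝ} {z : Z} {A : Z →L[ℝ] ℝ} {K : NNReal} {T : Set Z}
    (hA : IsFrechetSubgradient f z A) (hf : LipschitzOnWith K f T) (hT : T ∈ 𝓝 z) :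
    ‖A‖ ≤ K := by
  obtain ⟨g, -, hg, hmin⟩ := hA
  refine ContinuousLinearMap.opNorm_le_bound _ K.2 fun v => ?_
  have upper : ∀ v, A v ≤ K * ‖v‖ := by
    intro v
    have hline : HasDerivAt (fun t : ℝ => g (z + t • v)) (A v) 0 := by
      have h1 : HasDerivAt (fun t : ℝ => z + t • v) v 0 := by
        simpa using ((hasDerivAt_id (0 : ℝ)).smul_const v).const_add z
      have h2 : HasFDerivAt g A (z + (0 : ℝ) • v) := by simpa using hg
      exact h2.comp_hasDerivAt 0 h1
    refine le_of_tendsto hline.tendsto_slope_zero_right ?_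
    have hc : Tendsto (fun t : ℝ => z + t • v) (𝓝[>] 0) (𝓝 z) := by
      have : Continuous fun t : ℝ => z + t • v := by fun_prop
      simpa using (this.tendsto 0).mono_left nhdsWithin_le_nhds
    filter_upwards [hc.eventually hmin, hc.eventually hT, self_mem_nhdsWithin] with t ht htT ht0
    have ht0 : 0 < t := ht0
    have hlip := hf.dist_le_mul _ htT _ (mem_of_mem_nhds hT)
    rw [Real.dist_eq, dist_eq_norm] at hlip
    have h3 : ‖z + t • v - z‖ = t * ‖v‖ := by
      rw [add_sub_cancel_left, norm_smul, Real.norm_eq_abs, abs_of_pos ht0]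
    rw [h3] at hlip
    have h4 := (le_abs_self _).trans hlip
    rw [zero_add, zero_smul, add_zero, smul_eq_mul, inv_mul_le_iff₀ ht0]
    linarith
  rw [Real.norm_eq_abs, abs_le]
  refine ⟨?_, upper v⟩
  have := upper (-v)
  rw [map_neg, norm_neg] at this
  linarith

variable [FiniteDimensional ℝ V] [FiniteDimensional ℝ Z]

/-- Decoupling: a minimizer `c` of `J + κ Φ ∘ G` on `X` is approximated by points at which a
stationarity condition with Fréchet subgradients of `Φ` and Fréchet normals holds. -/
lemma exists_frechet_stationary_near {J : V → ℝ} {G : V → Z} {Φ : Z → ℝ} {Ω X : Set V} {T : Set Z}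
    {c : V} {κ : ℝ} (hκ : 0 < κ) (hX : IsCompact X) (hXc : X ∈ 𝓝[Ω] c) (hXΩ : X ⊆ Ω) (hc : c ∈ X)
    (hT : IsCompact T) (hTc : T ∈ 𝓝 (G c)) (hΦ : ContinuousOn Φ T)
    (hJ : ∀ x ∈ X, ContDiffAt ℝ 1 J x) (hG : ∀ x ∈ X, ContDiffAt ℝ 1 G x)
    (hmin : ∀ x ∈ X, J c + κ * Φ (G c) ≤ J x + κ * Φ (G x))
    {W : Set V} (hW : W ∈ 𝓝 c) {W' : Set Z} (hW' : W' ∈ 𝓝 (G c)) :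
    ∃ x ∈ W ∩ X, ∃ z ∈ W', ∃ A, IsFrechetSubgradient Φ z A ∧
      IsFrechetNormal Ω x
        (-(fderiv ℝ J x + fderiv ℝ euclSq (x - c) + κ • A.comp (fderiv ℝ G x))) := by
  obtain ⟨O, hO, hcO, hOX⟩ := mem_nhdsWithin.1 hXc
  have hJc : ContinuousOn J X := fun x hx => (hJ x hx).continuousAt.continuousWithinAt
  have hGc : ContinuousOn G X := fun x hx => (hG x hx).continuousAt.continuousWithinAt
  have hfst : MapsTo (Prod.fst : V × Z → V) (X ×ˢ T) X := fun p hp => hp.1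
  have hsnd : MapsTo (Prod.snd : V × Z → Z) (X ×ˢ T) T := fun p hp => hp.2
  have hsq : Continuous (euclSq : V → ℝ) := contDiff_euclSq.continuous
  have hsq' : Continuous (euclSq : Z → ℝ) := contDiff_euclSq.continuous
  -- The term `euclSq (p.1 - c)` makes `(c, G c)` the only minimizer of `f` on the graph of `G`, and
  -- `g` vanishes exactly on that graph.
  set f : V × Z → ℝ := fun p => J p.1 + euclSq (p.1 - c) + κ * Φ p.2 with hfdef
  set g : V × Z → ℝ := fun p => euclSq (p.2 - G p.1) with hgdef
  have hf : ContinuousOn f (X ×ˢ T) :=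
    ((hJc.comp continuousOn_fst hfst).add
      (hsq.comp (continuous_fst.sub continuous_const)).continuousOn).add
      (continuousOn_const.mul (hΦ.comp continuousOn_snd hsnd))
  have hg : ContinuousOn g (X ×ˢ T) :=
    hsq'.comp_continuousOn (continuousOn_snd.sub (hGc.comp continuousOn_fst hfst))
  have huniq : ∀ p ∈ X ×ˢ T, g p = 0 → f p ≤ f (c, G c) → p = (c, G c) := by
    rintro ⟨x, z⟩ ⟨hx, hz⟩ h0 hle
    have hz : z = G x := sub_eq_zero.1 (eq_zero_of_euclSq_le_zero h0.le)
    subst hz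
    have h1 := hmin x hx
    simp only [hfdef, sub_self, euclSq_zero] at hle
    have : x = c := sub_eq_zero.1 (eq_zero_of_euclSq_le_zero (by linarith))
    rw [this]
  -- `O` ensures that `X` and `Ω` agree near `x`, so that the normal is one to `Ω`; `interior T`
  -- makes the minimum in `z` unconstrained.
  have hWW : (W ∩ O) ×ˢ (W' ∩ interior T) ∈ 𝓝 ((c, G c) : V × Z) :=
    prod_mem_nhds (inter_mem hW (hO.mem_nhds hcO))
      (inter_mem hW' (interior_mem_nhds.2 hTc))
  obtain ⟨N₀, hN₀⟩ := (hX.prod hT).exists_penalty_localizes hf hg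
    (fun p _ => euclSq_nonneg _) huniq hWW
  set N := max N₀ 1
  obtain ⟨⟨x, z⟩, ⟨hx, hz⟩, hxz⟩ := (hX.prod hT).exists_isMinOn
    ⟨(c, G c), hc, mem_of_mem_nhds hTc⟩ (hf.add (continuousOn_const (c := N).mul hg))
  replace hxz : ∀ p ∈ X ×ˢ T, f (x, z) + N * g (x, z) ≤ f p + N * g p := fun p hp => hxz hp
  have hle : f (x, z) + N * g (x, z) ≤ f (c, G c) := by
    have := hxz (c, G c) ⟨hc, mem_of_mem_nhds hTc⟩
    simpa [hgdef] using this
  obtain ⟨⟨hxW, hxO⟩, hzW, hzT⟩ := hN₀ N (le_max_left _ _) _ ⟨hx, hz⟩ hle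
  have hsqz : HasFDerivAt (fun y => euclSq (y - G x)) (fderiv ℝ euclSq (z - G x)) z := by
    simpa using ((hasFDerivAt_id z).sub_const (G x)).euclSq
  have hNκ : κ * (N / κ) = N := by field_simp
  -- With `x` fixed, `κ Φ + N euclSq (· - G x)` has a local minimum at `z`; division by `κ` gives
  -- this subgradient `A`. With `z` fixed, the derivative of `N euclSq (z - G ·)` at `x` is then `κ
  -- • A.comp (fderiv ℝ G x)`.
  refine ⟨x, ⟨hxW, hx⟩, z, hzW, -((N / κ) • fderiv ℝ euclSq (z - G x)), ?_, hXΩ hx, ?_⟩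
  · refine ⟨fun y => -((N / κ) * euclSq (y - G x)), ?_, ?_, ?_⟩
    · exact (contDiffAt_const.mul
        (contDiff_euclSq.contDiffAt.comp z (contDiffAt_id.sub contDiffAt_const))).neg
    · exact (hsqz.const_mul (N / κ)).neg
    · filter_upwards [mem_interior_iff_mem_nhds.1 hzT] with y hy
      have h1 := hxz (x, y) ⟨hx, hy⟩
      simp only [hfdef, hgdef] at h1
      have h2 : κ * (Φ z + N / κ * euclSq (z - G x)) ≤ κ * (Φ y + N / κ * euclSq (y - G x)) := by
        rw [mul_add, mul_add, ← mul_assoc, ← mul_assoc, hNκ]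
        linarith
      have := le_of_mul_le_mul_left h2 hκ
      linarith
  · refine ⟨fun y => -(J y + euclSq (y - c) + N * euclSq (z - G y)), ?_, ?_, ?_⟩
    · refine (((hJ x hx).add (contDiff_euclSq.contDiffAt.comp x
        (contDiffAt_id.sub contDiffAt_const))).add (contDiffAt_const.mul
        (contDiff_euclSq.contDiffAt.comp x (contDiffAt_const.sub (hG x hx))))).neg
    · have hJx := ((hJ x hx).differentiableAt one_ne_zero).hasFDerivAt
      have hGx := ((hG x hx).differentiableAt one_ne_zero).hasFDerivAt
      have h1 : HasFDerivAt (fun y => euclSq (y - c)) (fderiv ℝ euclSq (x - c)) x := by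
        simpa using ((hasFDerivAt_id x).sub_const c).euclSq
      have h2 : HasFDerivAt (fun y => euclSq (z - G y))
          ((fderiv ℝ euclSq (z - G x)).comp (-fderiv ℝ G x)) x :=
        (hGx.const_sub z).euclSq
      have h3 := ((hJx.add h1).add (h2.const_mul N)).neg
      refine h3.congr_fderiv ?_
      ext v
      simp only [neg_apply, add_apply,
        smul_apply, ContinuousLinearMap.comp_apply, smul_eq_mul, map_neg,
        mul_neg, ← mul_assoc, hNκ]
    · filter_upwards [inter_mem_nhdsWithin Ω (hO.mem_nhds hxO)] with y hy
      have h1 := hxz (y, z) ⟨hOX ⟨hy.2, hy.1⟩, hz⟩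
      simp only [hfdef, hgdef] at h1
      linarith

end FrechetVector

/-! ### Penalised minimizers and the multiplier rule. -/

section PenaltySequence

/-- Either `u` minimizes a penalised function, or there are minimizers `cₖ → u` of penalised
functions, with vanishing weight on `f`, at which the constraint is violated. -/
lemma IsCompact.exists_penalized_minimizers {V : Type*} [TopologicalSpace V]
    {X : Set V} (hX : IsCompact X) {f h : V → ℝ} (hf : ContinuousOn f X) (hh : ContinuousOn h X)
    (hh0 : ∀ x ∈ X, 0 ≤ h x) {u : V} (hu : u ∈ X) (hu0 : h u = 0)
    (huniq : ∀ x ∈ X, h x = 0 → f x ≤ f u → x = u) {W : Set V} (hW : W ∈ 𝓝 u) :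
    ∃ (l κ : ℝ) (ls : ℕ → ℝ) (cs : ℕ → V), (l = 0 ∨ l = 1) ∧ 0 < κ ∧ (l = 0 → κ = 1) ∧
      Tendsto ls atTop (𝓝 l) ∧ Tendsto cs atTop (𝓝 u) ∧ (∀ k, cs k ∈ X ∩ W) ∧
      (∀ k, ∀ x ∈ X, ls k * f (cs k) + κ * h (cs k) ≤ ls k * f x + κ * h x) ∧
      (l = 0 → ∀ k, cs k ≠ u ∧ 0 < h (cs k)) := by
  obtain ⟨N₀, hN₀⟩ := hX.exists_penalty_localizes hf hh hh0 huniq hW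
  set N : ℕ → ℝ := fun k => max N₀ 0 + (k + 1) with hN
  have hNpos : ∀ k, 0 < N k := fun k => by
    have := le_max_right N₀ 0
    simp only [hN]
    positivity
  have hex : ∀ k, ∃ c ∈ X, ∀ x ∈ X, f c + N k * h c ≤ f x + N k * h x := fun k =>
    hX.exists_isMinOn ⟨u, hu⟩ (hf.add (continuousOn_const.mul hh))
  choose cs hcX hcmin using hex
  have hle : ∀ k, f (cs k) + N k * h (cs k) ≤ f u := fun k => by
    simpa [hu0] using hcmin k u hu
  -- If some minimizer equals `u`, the penalty is exact and constant sequences suffice. Otherwise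
  -- the objective is divided by `N k`, so that the weight on `f` tends to `0`.
  by_cases hcase : ∃ k, cs k = u
  · obtain ⟨k, hk⟩ := hcase
    refine ⟨1, N k, fun _ => 1, fun _ => u, Or.inr rfl, hNpos k, by simp, tendsto_const_nhds,
      tendsto_const_nhds, fun _ => ⟨hu, mem_of_mem_nhds hW⟩, fun _ x hx => ?_, by simp⟩
    have := hcmin k x hx
    rw [hk] at this
    simpa using this
  · push Not at hcase
    have hNtop : Tendsto N atTop atTop :=
      tendsto_atTop_add_const_left _ _
        (tendsto_atTop_add_const_right _ _ tendsto_natCast_atTop_atTop)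
    refine ⟨0, 1, fun k => (N k)⁻¹, cs, Or.inl rfl, one_pos, fun _ => rfl,
      tendsto_inv_atTop_zero.comp hNtop, fun W' hW' => ?_, fun k => ⟨hcX k, ?_⟩,
      fun k x hx => ?_, fun _ k => ⟨hcase k, ?_⟩⟩
    · rw [Filter.mem_map]
      obtain ⟨N₁, hN₁⟩ := hX.exists_penalty_localizes hf hh hh0 huniq hW'
      filter_upwards [hNtop.eventually_ge_atTop N₁] with k hk
      exact hN₁ _ hk _ (hcX k) (hle k)
    · exact hN₀ _ ((le_max_left N₀ 0).trans (by simp only [hN]; linarith [k.cast_nonneg (α := ℝ)]))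
        _ (hcX k) (hle k)
    · have h1 := mul_le_mul_of_nonneg_left (hcmin k x hx) (inv_nonneg.2 (hNpos k).le)
      simpa [mul_add, inv_mul_cancel_left₀ (hNpos k).ne'] using h1
    -- If `h` vanished here, `cs k` would be feasible with `f (cs k) ≤ f u`, hence equal to `u`.
    · refine (hh0 _ (hcX k)).lt_of_ne fun h0 => hcase k (huniq _ (hcX k) h0.symm ?_)
      simpa [← h0] using hle k

end PenaltySequence

section Multipliers

variable {V : Type*} [NormedAddCommGroup V] [NormedSpace ℝ V] [FiniteDimensional ℝ V]
  {Z : Type*} [NormedAddCommGroup Z] [NormedSpace ℝ Z] [FiniteDimensional ℝ Z]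

/-- Sequential multiplier rule: `u` is a local minimizer of `J` on `Ω` under `Φ (G c) = 0`. -/
theorem exists_multiplier_sequences {J : V → ℝ} {G : V → Z} {Φ : Z → ℝ} {Ω : Set V} {u : V}
    (hJ : ContDiffAt ℝ 1 J u) (hG : ContDiffAt ℝ 1 G u)
    (hΩ : ∃ s ∈ 𝓝 u, IsClosed (s ∩ Ω)) (hΦ : ∃ K, ∃ T ∈ 𝓝 (G u), LipschitzOnWith K Φ T)
    (hΦ0 : ∀ z, 0 ≤ Φ z) (hu : u ∈ Ω) (hu0 : Φ (G u) = 0)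
    (hmin : ∀ᶠ c in 𝓝[Ω] u, Φ (G c) = 0 → J u ≤ J c) :
    ∃ (l κ : ℝ) (cs : ℕ → V) (zs : ℕ → Z) (A : ℕ → Z →L[ℝ] ℝ) (B : ℕ → V →L[ℝ] ℝ)
      (A₀ : Z →L[ℝ] ℝ) (B₀ : V →L[ℝ] ℝ),
      (l = 0 ∨ l = 1) ∧ 0 < κ ∧ (l = 0 → κ = 1) ∧
      Tendsto cs atTop (𝓝 u) ∧ Tendsto zs atTop (𝓝 (G u)) ∧
      (∀ k, IsFrechetSubgradient Φ (zs k) (A k)) ∧ (∀ k, IsFrechetNormal Ω (cs k) (B k)) ∧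
      Tendsto A atTop (𝓝 A₀) ∧ Tendsto B atTop (𝓝 B₀) ∧
      l • fderiv ℝ J u + κ • A₀.comp (fderiv ℝ G u) + B₀ = 0 ∧
      (l = 0 → Nontrivial V ∧ ∀ k, 0 < Φ (zs k)) := by
  obtain ⟨S, hSu, hS⟩ := hΩ
  obtain ⟨K, T₀, hT₀, hK⟩ := hΦ
  obtain ⟨ρ, hρ, hρT⟩ := Metric.nhds_basis_closedBall.mem_iff.1 hT₀
  set T := Metric.closedBall (G u) ρ with hTdef
  have hT : IsCompact T := isCompact_closedBall _ _
  have hΦT : LipschitzOnWith K Φ T := hK.mono hρT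
  have hJev : ∀ᶠ x in 𝓝 u, ContDiffAt ℝ 1 J x := hJ.eventually (by simp)
  have hGev : ∀ᶠ x in 𝓝 u, ContDiffAt ℝ 1 G x := hG.eventually (by simp)
  have hGT : ∀ᶠ x in 𝓝 u, G x ∈ Metric.ball (G u) ρ :=
    hG.continuousAt.eventually (Metric.ball_mem_nhds _ hρ)
  obtain ⟨r, hr, hrall⟩ := Metric.nhds_basis_closedBall.eventually_iff.1
    (((hJev.and hGev).and (hGT.and (eventually_nhdsWithin_iff.1 hmin))).and hSu)
  set X := Metric.closedBall u r ∩ Ω with hXdef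
  have hXS : X = Metric.closedBall u r ∩ (S ∩ Ω) := by
    ext x
    constructor
    · rintro ⟨h1, h2⟩
      exact ⟨h1, (hrall h1).2, h2⟩
    · rintro ⟨h1, h2⟩
      exact ⟨h1, h2.2⟩
  have hX : IsCompact X := by
    rw [hXS]
    exact (isCompact_closedBall _ _).inter_right hS
  have hXJ : ∀ x ∈ X, ContDiffAt ℝ 1 J x := fun x hx => (hrall hx.1).1.1.1
  have hXG : ∀ x ∈ X, ContDiffAt ℝ 1 G x := fun x hx => (hrall hx.1).1.1.2
  have hXT : ∀ x ∈ X, T ∈ 𝓝 (G x) := fun x hx =>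
    mem_of_superset (Metric.isOpen_ball.mem_nhds (hrall hx.1).1.2.1) Metric.ball_subset_closedBall
  have hXmin : ∀ x ∈ X, Φ (G x) = 0 → J u ≤ J x := fun x hx => (hrall hx.1).1.2.2 hx.2
  have huX : u ∈ X := ⟨Metric.mem_closedBall_self hr.le, hu⟩
  -- The quadratic term makes `u` the only feasible minimizer in `X`. Its derivative vanishes at
  -- `u`, so it disappears in the limit.
  set f : V → ℝ := fun x => J x + euclSq (x - u) with hfdef
  have hfC : ∀ x ∈ X, ContDiffAt ℝ 1 f x := fun x hx =>
    (hXJ x hx).add (contDiff_euclSq.contDiffAt.comp x (contDiffAt_id.sub contDiffAt_const))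
  have hfd : ∀ x ∈ X, fderiv ℝ f x = fderiv ℝ J x + fderiv ℝ euclSq (x - u) := by
    intro x hx
    have h1 := ((hXJ x hx).differentiableAt one_ne_zero).hasFDerivAt
    have h2 : HasFDerivAt (fun y => euclSq (y - u)) (fderiv ℝ euclSq (x - u)) x := by
      simpa using ((hasFDerivAt_id x).sub_const u).euclSq
    exact (h1.add h2).fderiv
  have hΦG : ContinuousOn (fun x => Φ (G x)) X := fun x hx =>
    (((hΦT.continuousOn).continuousAt (hXT x hx)).comp
      (hXG x hx).continuousAt).continuousWithinAt
  obtain ⟨l, κ, ls, ds, hl, hκ, hlκ, hls, hds, hdX, hdmin, hd0⟩ :=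
    hX.exists_penalized_minimizers (f := f) (h := fun x => Φ (G x)) (u := u)
      (fun x hx => (hfC x hx).continuousAt.continuousWithinAt) hΦG
      (fun x _ => hΦ0 _) huX hu0 (fun x hx h0 hle => by
        have h1 := hXmin x hx h0
        simp only [hfdef, sub_self, euclSq_zero] at hle
        exact sub_eq_zero.1 (eq_zero_of_euclSq_le_zero (by linarith)))
      (Metric.ball_mem_nhds u hr)
  have hXd : ∀ k, X ∈ 𝓝[Ω] (ds k) := fun k =>
    mem_of_superset (inter_mem_nhdsWithin Ω (Metric.isOpen_ball.mem_nhds (hdX k).2))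
      fun x hx => ⟨Metric.ball_subset_closedBall hx.2, hx.1⟩
  -- The decoupled points are taken within `1 / (k + 1)` of `ds k` and `G (ds k)`. When `l = 0` they
  -- also keep `Φ > 0`, an open condition on `interior T` by continuity.
  have hnear : ∀ k : ℕ, ∃ x ∈ Metric.ball (ds k) (1 / ((k : ℝ) + 1)) ∩ X,
      ∃ z ∈ Metric.ball (G (ds k)) (1 / ((k : ℝ) + 1)) ∩ interior T ∩
        {z | l = 0 → 0 < Φ z}, ∃ A, IsFrechetSubgradient Φ z A ∧
      IsFrechetNormal Ω x (-(fderiv ℝ (fun y => ls k * f y) x + fderiv ℝ euclSq (x - ds k) +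
        κ • A.comp (fderiv ℝ G x))) := by
    intro k
    have hpos : 0 < 1 / ((k : ℝ) + 1) := by positivity
    refine exists_frechet_stationary_near hκ hX (hXd k) inter_subset_right (hdX k).1 hT
      (hXT _ (hdX k).1) hΦT.continuousOn (fun x hx => contDiffAt_const.mul (hfC x hx)) hXG
      (hdmin k) (Metric.ball_mem_nhds _ hpos)
      (inter_mem (inter_mem (Metric.ball_mem_nhds _ hpos)
        (interior_mem_nhds.2 (hXT _ (hdX k).1))) ?_)
    by_cases h0 : l = 0
    · have hcont := hΦT.continuousOn.continuousAt (hXT _ (hdX k).1)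
      filter_upwards [hcont.eventually_const_lt (hd0 h0 k).2] with z hz _ using hz
    · exact Eventually.of_forall fun z h => absurd h h0
  choose cs hcs zs hzs A hA hB using hnear
  have hone : Tendsto (fun k : ℕ => 1 / ((k : ℝ) + 1)) atTop (𝓝 0) :=
    tendsto_one_div_add_atTop_nhds_zero_nat
  have hcd : Tendsto (fun k => cs k - ds k) atTop (𝓝 0) := by
    rw [tendsto_zero_iff_norm_tendsto_zero]
    exact squeeze_zero (fun _ => norm_nonneg _)
      (fun k => by simpa [dist_eq_norm] using (Metric.mem_ball.1 (hcs k).1).le) hone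
  have hcu : Tendsto cs atTop (𝓝 u) := by simpa using hcd.add hds
  have hGd : Tendsto (fun k => G (ds k)) atTop (𝓝 (G u)) := hG.continuousAt.tendsto.comp hds
  have hzG : Tendsto zs atTop (𝓝 (G u)) := by
    have h1 : Tendsto (fun k => zs k - G (ds k)) atTop (𝓝 0) := by
      rw [tendsto_zero_iff_norm_tendsto_zero]
      exact squeeze_zero (fun _ => norm_nonneg _)
        (fun k => by simpa [dist_eq_norm] using (Metric.mem_ball.1 (hzs k).1.1).le) hone
    simpa using h1.add hGd
  have hAbd : ∀ k, A k ∈ Metric.closedBall (0 : Z →L[ℝ] ℝ) K := fun k => by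
    simpa using (hA k).norm_le hΦT (mem_interior_iff_mem_nhds.1 (hzs k).1.2)
  have hprop : ProperSpace (Z →L[ℝ] ℝ) := FiniteDimensional.proper_real _
  obtain ⟨A₀, -, σ, hσ, hAσ⟩ := (isCompact_closedBall (0 : Z →L[ℝ] ℝ) K).tendsto_subseq hAbd
  have hσt := hσ.tendsto_atTop
  replace hAσ : Tendsto (fun k => A (σ k)) atTop (𝓝 A₀) := hAσ
  have hJd : Tendsto (fun k => fderiv ℝ J (cs (σ k))) atTop (𝓝 (fderiv ℝ J u)) :=
    (hJ.continuousAt_fderiv one_ne_zero).tendsto.comp (hcu.comp hσt)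
  have hGd' : Tendsto (fun k => fderiv ℝ G (cs (σ k))) atTop (𝓝 (fderiv ℝ G u)) :=
    (hG.continuousAt_fderiv one_ne_zero).tendsto.comp (hcu.comp hσt)
  have hsq1 : Tendsto (fun k => fderiv ℝ euclSq (cs (σ k) - u)) atTop (𝓝 (0 : V →L[ℝ] ℝ)) := by
    have h1 := (continuous_fderiv_euclSq (V := V)).tendsto 0
    rw [fderiv_euclSq_zero] at h1
    refine h1.comp ?_
    simpa using (hcu.comp hσt).sub_const u
  have hsq2 : Tendsto (fun k => fderiv ℝ euclSq (cs (σ k) - ds (σ k))) atTop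
      (𝓝 (0 : V →L[ℝ] ℝ)) := by
    have h1 := (continuous_fderiv_euclSq (V := V)).tendsto 0
    rw [fderiv_euclSq_zero] at h1
    exact h1.comp (hcd.comp hσt)
  have hf1 : ∀ k, fderiv ℝ (fun y => ls k * f y) (cs k) =
      ls k • (fderiv ℝ J (cs k) + fderiv ℝ euclSq (cs k - u)) := fun k => by
    rw [← hfd _ (hcs k).2]
    exact fderiv_const_mul ((hfC _ (hcs k).2).differentiableAt one_ne_zero) _
  -- The normals are determined by the other terms of the stationarity condition, so their limit
  -- `B₀` is read off and needs no separate compactness argument.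
  refine ⟨l, κ, cs ∘ σ, zs ∘ σ, A ∘ σ, _, A₀,
    -(l • fderiv ℝ J u + κ • A₀.comp (fderiv ℝ G u)), hl, hκ, hlκ, hcu.comp hσt, hzG.comp hσt,
    fun k => hA _, fun k => hB (σ k), hAσ, ?_, ?_, fun h0 => ⟨?_, fun k => (hzs _).2 h0⟩⟩
  · simp only [hf1]
    have hcomp : Tendsto (fun k => (A (σ k)).comp (fderiv ℝ G (cs (σ k)))) atTop
        (𝓝 (A₀.comp (fderiv ℝ G u))) :=
      (isBoundedBilinearMap_comp (𝕜 := ℝ)).continuous.tendsto (A₀, fderiv ℝ G u) |>.comp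
        (hAσ.prodMk_nhds hGd')
    have h2 := (((hls.comp hσt).smul (hJd.add hsq1)).add hsq2).add
      (hcomp.const_smul κ)
    simpa using h2.neg
  · exact add_neg_cancel _
  -- In the abnormal case the minimizers differ from `u`, which excludes a zero-dimensional control
  -- space.
  · exact ⟨ds 0, u, (hd0 h0 0).1⟩

end Multipliers

/-! ### From charts to covectors on manifolds. -/

section ChartTransfer

variable {E : Type*} [NormedAddCommGroup E] [NormedSpace ℝ E]
  {H : Type*} [TopologicalSpace H] {I : ModelWithCorners ℝ E H}
  {M : Type*} [TopologicalSpace M] [ChartedSpace H M]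

/-- A test function that is only locally `C¹` is multiplied by a bump function supported where it is
`C¹`; this makes it globally `C¹` and does not change it near `x`. -/
lemma mfderiv_mem_frechetSubdifferential [FiniteDimensional ℝ E] [T2Space M] [IsManifold I ∞ M]
    {f : M → EReal} {g : M → ℝ} {x : M}
    (hg : ContMDiffAt I 𝓘(ℝ, ℝ) 1 g x) (hf : f x ≠ ⊤)
    (hmin : IsLocalMin (fun y => f y - (g y : EReal)) x) :
    (mfderiv I 𝓘(ℝ, ℝ) g x : Covector I x) ∈ frechetSubdifferential I f x := by
  obtain ⟨s, hs, hgs⟩ := (contMDiffAt_iff_contMDiffOn_nhds (by simp)).1 hg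
  obtain ⟨b, -, hb⟩ := (SmoothBumpFunction.nhds_basis_tsupport (I := I) x).mem_iff.1
    (interior_mem_nhds.2 hs)
  have hbg : (fun y => b y • g y) =ᶠ[𝓝 x] g := by
    filter_upwards [b.eventuallyEq_one] with y hy
    simp [hy]
  have hsmooth : ContMDiff I 𝓘(ℝ, ℝ) 1 fun y => b y • g y := by
    refine contMDiff_of_tsupport fun y hy => ?_
    have hy' : y ∈ interior s := hb (tsupport_smul_subset_left _ _ hy)
    exact (b.contMDiffAt.of_le (by simp)).smul
      ((hgs y (interior_subset hy')).contMDiffAt (mem_interior_iff_mem_nhds.1 hy'))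
  refine ⟨hf, _, hsmooth, hbg.mfderiv_eq.symm, ?_⟩
  have h0 : b x • g x = g x := hbg.eq_of_nhds
  filter_upwards [hmin, hbg] with y hy hyg
  rw [hyg, h0]
  exact hy

variable [IsManifold I ∞ M]

/-- The tangent space at `x` is identified with `E` by the preferred chart at `x`, so the coordinate
change involved is the identity. -/
lemma mfderiv_extChartAt_self_apply (x : M) (v : TangentSpace I x) :
    (mfderiv I 𝓘(ℝ, E) (extChartAt I x) x v : E) = v := by
  rw [← TangentBundle.continuousLinearMapAt_trivializationAt (mem_chart_source H x),
    TangentBundle.continuousLinearMapAt_trivializationAt_eq_core (mem_chart_source H x)]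
  exact (tangentBundleCore I M).coordChange_self _ _ (mem_achart_source H x) v

lemma hom_trivializationAt_comp_mfderiv_extChartAt {x₀ x : M} (hx : x ∈ (chartAt H x₀).source)
    (P : E →L[ℝ] ℝ) :
    (trivializationAt (E →L[ℝ] ℝ) (fun y : M => TangentSpace I y →L[ℝ] Bundle.Trivial M ℝ y) x₀
      ⟨x, P.comp (mfderiv I 𝓘(ℝ, E) (extChartAt I x₀) x)⟩).2 = P := by
  rw [hom_trivializationAt_apply, ← TangentBundle.continuousLinearMapAt_trivializationAt hx]
  ext v
  have hx' : x ∈ (trivializationAt E (TangentSpace I : M → Type _) x₀).baseSet := hx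
  simp only [ContinuousLinearMap.inCoordinates, ContinuousLinearMap.comp_apply]
  rw [Trivialization.continuousLinearMapAt_symmL _ hx']
  simp

/-- In the trivialization at `x₀` the pulled-back covectors have coordinates `Ps k`, so convergence
in the cotangent bundle reduces to convergence in the dual of `E`. -/
lemma covectorTendsto_of_chart {x₀ : M} {xs : ℕ → M} {Ps : ℕ → E →L[ℝ] ℝ} {P : E →L[ℝ] ℝ}
    (hxs : Tendsto xs atTop (𝓝 x₀)) (hPs : Tendsto Ps atTop (𝓝 P)) :
    CovectorTendsto I xs
      (fun k => (Ps k).comp (mfderiv I 𝓘(ℝ, E) (extChartAt I x₀) (xs k))) x₀ P := by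
  unfold CovectorTendsto
  rw [(trivializationAt (E →L[ℝ] ℝ) (fun y : M => TangentSpace I y →L[ℝ] Bundle.Trivial M ℝ y)
    x₀).tendsto_nhds_iff (by simp)]
  refine ⟨hxs, ?_⟩
  have h0 : (P : Covector I x₀) = P.comp (mfderiv I 𝓘(ℝ, E) (extChartAt I x₀) x₀) := by
    ext v
    exact congrArg P (mfderiv_extChartAt_self_apply x₀ v).symm
  rw [h0, hom_trivializationAt_comp_mfderiv_extChartAt (mem_chart_source H x₀)]
  refine hPs.congr' ?_
  filter_upwards [hxs.eventually (chart_source_mem_nhds H x₀)] with k hk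
  exact (hom_trivializationAt_comp_mfderiv_extChartAt hk _).symm

end ChartTransfer

section ChartSubgradients

variable {E : Type*} [NormedAddCommGroup E] [NormedSpace ℝ E]
  {H : Type*} [TopologicalSpace H] {I : ModelWithCorners ℝ E H}
  {M : Type*} [TopologicalSpace M] [ChartedSpace H M]
  [FiniteDimensional ℝ E] [T2Space M] [IsManifold I ∞ M]

lemma comp_mfderiv_mem_frechetSubdifferential {f : M → EReal} {x₀ : M} {z : E}
    (hz : z ∈ (extChartAt I x₀).target) {g : E → ℝ} {A : E →L[ℝ] ℝ} (hg : ContDiffAt ℝ 1 g z)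
    (hgA : HasFDerivAt g A z) (hf : f ((extChartAt I x₀).symm z) ≠ ⊤)
    (hmin : IsLocalMin (fun y => f ((extChartAt I x₀).symm y) - (g y : EReal)) z) :
    (A.comp (mfderiv I 𝓘(ℝ, E) (extChartAt I x₀) ((extChartAt I x₀).symm z)) :
        Covector I ((extChartAt I x₀).symm z)) ∈
      frechetSubdifferential I f ((extChartAt I x₀).symm z) := by
  set e := extChartAt I x₀
  set x := e.symm z with hxdef
  have hx : x ∈ e.source := e.map_target hz
  have hxc : x ∈ (chartAt H x₀).source := by rwa [← extChartAt_source I]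
  have hex : e x = z := e.right_inv hz
  have he : ContMDiffAt I 𝓘(ℝ, E) 1 e x := (contMDiffAt_extChartAt' hxc)
  have hge : ContMDiffAt I 𝓘(ℝ, ℝ) 1 (g ∘ e) x := by
    refine ContMDiffAt.comp x ?_ he
    rw [hex]
    exact hg.contMDiffAt
  have hd : HasMFDerivAt I 𝓘(ℝ, ℝ) (g ∘ e) x (A.comp (mfderiv I 𝓘(ℝ, E) e x)) := by
    refine HasMFDerivAt.comp x ?_ (he.mdifferentiableAt one_ne_zero).hasMFDerivAt
    have hgA' : HasFDerivAt g A (e x) := by rwa [hex]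
    exact hgA'.hasMFDerivAt
  rw [← hd.mfderiv]
  refine mfderiv_mem_frechetSubdifferential hge hf ?_
  have hcont : Tendsto e (𝓝 x) (𝓝 z) := by
    have := he.continuousAt.tendsto
    rwa [hex] at this
  filter_upwards [hcont.eventually hmin, extChartAt_source_mem_nhds' hx] with y hy hys
  rw [e.left_inv hys] at hy
  simpa only [Function.comp_apply, hex] using hy

lemma mem_limitingSubdifferential_of_chart [I.Boundaryless] {f : M → EReal} {x₀ : M}
    {zs : ℕ → E} {A : ℕ → E →L[ℝ] ℝ} {A₀ : E →L[ℝ] ℝ}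
    (hzs : Tendsto zs atTop (𝓝 (extChartAt I x₀ x₀))) (hA : Tendsto A atTop (𝓝 A₀))
    (hfx : Tendsto (fun k => f ((extChartAt I x₀).symm (zs k))) atTop (𝓝 (f x₀)))
    (hf : ∀ k, f ((extChartAt I x₀).symm (zs k)) ≠ ⊤)
    (hsub : ∀ k, ∃ g : E → ℝ, ContDiffAt ℝ 1 g (zs k) ∧ HasFDerivAt g (A k) (zs k) ∧
      IsLocalMin (fun y => f ((extChartAt I x₀).symm y) - (g y : EReal)) (zs k)) :
    (A₀ : Covector I x₀) ∈ limitingSubdifferential I f x₀ := by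
  -- The inverse chart is meaningful only on its target, so the finitely many terms that may lie
  -- outside are dropped.
  obtain ⟨N, hN⟩ := eventually_atTop.1 (hzs.eventually (extChartAt_target_mem_nhds (I := I) x₀))
  have hshift : Tendsto (fun k => k + N) atTop atTop := tendsto_add_atTop_nat N
  have hxs : Tendsto (fun k => (extChartAt I x₀).symm (zs (k + N))) atTop (𝓝 x₀) := by
    have := (continuousAt_extChartAt_symm (I := I) x₀).tendsto.comp (hzs.comp hshift)
    rwa [extChartAt_to_inv] at this
  refine ⟨_, _, hxs, fun k => ?_, hfx.comp hshift, covectorTendsto_of_chart hxs (hA.comp hshift)⟩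
  obtain ⟨g, hg, hgA, hmin⟩ := hsub (k + N)
  exact comp_mfderiv_mem_frechetSubdifferential (hN _ (Nat.le_add_left _ _)) hg hgA (hf _) hmin

omit [FiniteDimensional ℝ E] [T2Space M] [IsManifold I ∞ M] in
lemma IsFrechetSubgradient.isLocalMin_ereal {f : M → ℝ} {x₀ : M} {z : E} {A : E →L[ℝ] ℝ}
    (hA : IsFrechetSubgradient (f ∘ (extChartAt I x₀).symm) z A) :
    ∃ g : E → ℝ, ContDiffAt ℝ 1 g z ∧ HasFDerivAt g A z ∧
      IsLocalMin (fun y => ((f ((extChartAt I x₀).symm y) : ℝ) : EReal) - (g y : EReal)) z := by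
  obtain ⟨g, hg, hgA, hmin⟩ := hA
  refine ⟨g, hg, hgA, hmin.mono fun y hy => ?_⟩
  exact EReal.coe_le_coe_iff.2 hy

/-- Constant sequences suffice. This puts the approximating subgradients within reach of the lower
bound in `IsPhiRegularAt`. -/
lemma IsFrechetSubgradient.comp_mfderiv_mem_limitingSubdifferentialReal {f : M → ℝ} {x₀ : M}
    {z : E} {A : E →L[ℝ] ℝ} (hA : IsFrechetSubgradient (f ∘ (extChartAt I x₀).symm) z A)
    (hz : z ∈ (extChartAt I x₀).target) :
    (A.comp (mfderiv I 𝓘(ℝ, E) (extChartAt I x₀) ((extChartAt I x₀).symm z)) :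
        Covector I ((extChartAt I x₀).symm z)) ∈
      limitingSubdifferentialReal I f ((extChartAt I x₀).symm z) := by
  obtain ⟨g, hg, hgA, hmin⟩ := hA.isLocalMin_ereal
  exact ⟨fun _ => _, fun _ => _, tendsto_const_nhds, fun _ =>
    comp_mfderiv_mem_frechetSubdifferential hz hg hgA (EReal.coe_ne_top _) hmin,
    tendsto_const_nhds, tendsto_const_nhds⟩

variable [I.Boundaryless]

lemma mem_limitingSubdifferentialReal_of_chart {f : M → ℝ} {x₀ : M}
    (hf : ContinuousAt f x₀)
    {zs : ℕ → E} {A : ℕ → E →L[ℝ] ℝ} {A₀ : E →L[ℝ] ℝ}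
    (hzs : Tendsto zs atTop (𝓝 (extChartAt I x₀ x₀))) (hA : Tendsto A atTop (𝓝 A₀))
    (hsub : ∀ k, IsFrechetSubgradient (f ∘ (extChartAt I x₀).symm) (zs k) (A k)) :
    (A₀ : Covector I x₀) ∈ limitingSubdifferentialReal I f x₀ := by
  refine mem_limitingSubdifferential_of_chart hzs hA ?_ (fun _ => EReal.coe_ne_top _)
    fun k => (hsub k).isLocalMin_ereal
  have h1 := (continuousAt_extChartAt_symm (I := I) x₀).tendsto.comp hzs
  rw [extChartAt_to_inv] at h1
  exact (continuous_coe_real_ereal.tendsto _).comp (hf.tendsto.comp h1)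

lemma mem_limitingNormalCone_of_chart {S : Set M} {x₀ : M} (hx₀ : x₀ ∈ S)
    {cs : ℕ → E} {B : ℕ → E →L[ℝ] ℝ} {B₀ : E →L[ℝ] ℝ}
    (hcs : Tendsto cs atTop (𝓝 (extChartAt I x₀ x₀))) (hB : Tendsto B atTop (𝓝 B₀))
    (hn : ∀ k, IsFrechetNormal ((extChartAt I x₀).symm ⁻¹' S) (cs k) (B k)) :
    (B₀ : Covector I x₀) ∈ limitingNormalCone I S x₀ := by
  have h0 : ∀ x ∈ S, indicatorInfty S x = 0 := fun x hx => by simp [indicatorInfty, hx]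
  refine mem_limitingSubdifferential_of_chart hcs hB ?_ (fun k => ?_) fun k => ?_
  · rw [h0 x₀ hx₀]
    exact tendsto_const_nhds.congr fun k => (h0 _ (hn k).1).symm
  · rw [h0 _ (hn k).1]
    exact EReal.zero_ne_top
  · obtain ⟨hc, s, hs, hsB, hmax⟩ := hn k
    refine ⟨s, hs, hsB, ?_⟩
    filter_upwards [eventually_nhdsWithin_iff.1 hmax] with y hy
    rw [h0 _ hc]
    by_cases hyS : (extChartAt I x₀).symm y ∈ S
    · rw [h0 _ hyS]
      simpa only [← EReal.coe_zero, ← EReal.coe_sub, EReal.coe_le_coe_iff, zero_sub,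
        neg_le_neg_iff] using hy hyS
    · have : indicatorInfty S ((extChartAt I x₀).symm y) = ⊤ := indicator_of_mem hyS _
      rw [this, EReal.top_sub_coe]
      exact le_top

/-- The differential at `x` of the preferred chart at `x₀`. -/
noncomputable def chartDifferential (I : ModelWithCorners ℝ E H) (x₀ x : M) :
    TangentSpace I x →L[ℝ] E :=
  mfderiv I 𝓘(ℝ, E) (extChartAt I x₀) x

/-- Limits of Fréchet subgradients at points with `f > 0` do not vanish. -/
lemma ne_zero_of_isPhiRegularAt {N : ∀ x : M, TangentSpace I x → ℝ} {f : M → ℝ} {x₀ : M}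
    (hreg : IsPhiRegularAt I N f x₀) (hN0 : ∀ x, N x 0 ≤ 1)
    (hN : ∃ C : ℝ, ∀ᶠ x in 𝓝 x₀, ∀ v : TangentSpace I x, N x v ≤ 1 →
      ‖chartDifferential I x₀ x v‖ ≤ C)
    {zs : ℕ → E} {A : ℕ → E →L[ℝ] ℝ} {A₀ : E →L[ℝ] ℝ}
    (hzs : Tendsto zs atTop (𝓝 (extChartAt I x₀ x₀))) (hA : Tendsto A atTop (𝓝 A₀))
    (hsub : ∀ k, IsFrechetSubgradient (f ∘ (extChartAt I x₀).symm) (zs k) (A k))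
    (hpos : ∃ᶠ k in atTop, 0 < f ((extChartAt I x₀).symm (zs k))) : A₀ ≠ 0 := by
  -- If `A k` tended to `0`, the dual norms of the pulled-back covectors would be at most `‖A k‖ *
  -- C`, and so would fall below `Δ`. The hypothesis `hN0` makes the set in the supremum nonempty.
  rintro rfl
  obtain ⟨⟨Δ, hΔ, hΔx⟩, -⟩ := hreg
  obtain ⟨C, hC⟩ := hN
  have hxs := (continuousAt_extChartAt_symm (I := I) x₀).tendsto.comp hzs
  rw [extChartAt_to_inv] at hxs
  have hsmall : Tendsto (fun k => ‖A k‖ * C) atTop (𝓝 0) := by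
    simpa using hA.norm.mul_const C
  obtain ⟨k, hk, ⟨⟨h1, h2⟩, h3⟩, h4⟩ := (hpos.and_eventually
    (((hxs.eventually hΔx).and (hxs.eventually hC)).and
      (hzs.eventually (extChartAt_target_mem_nhds (I := I) x₀)) |>.and
        (hsmall.eventually_lt_const hΔ))).exists
  have h5 := h1 hk _ ((hsub k).comp_mfderiv_mem_limitingSubdifferentialReal h3)
  refine absurd h4 (not_lt.2 (h5.trans (csSup_le ⟨_, 0, hN0 _, rfl⟩ ?_)))
  rintro _ ⟨v, hv, rfl⟩
  exact (le_abs_self _).trans (((A k).le_opNorm _).trans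
    (mul_le_mul_of_nonneg_left (h2 v hv) (norm_nonneg _)))

end ChartSubgradients

/-! ### Chart differentials of Riemannian unit balls. -/

section RiemannianBounds

variable {E : Type*} [NormedAddCommGroup E] [NormedSpace ℝ E]
  {Q : Type*} [TopologicalSpace Q] [ChartedSpace E Q] [IsManifold 𝓘(ℝ, E) ∞ Q]
  {F : Type*} [NormedAddCommGroup F] [NormedSpace ℝ F]
  {U : Type*} [TopologicalSpace U] [ChartedSpace F U] [IsManifold 𝓘(ℝ, F) ∞ U]

lemma RiemSq_zero (g : RiemMetric E Q) (x : Q) : RiemSq g x 0 = 0 := by simp [RiemSq]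

lemma RiemSq_nonneg (g : RiemMetric E Q) (x : Q) (v : TangentSpace 𝓘(ℝ, E) x) :
    0 ≤ RiemSq g x v := by
  rcases eq_or_ne v 0 with rfl | hv
  · rw [RiemSq_zero]
  · exact (g.pos x v hv).le

/-- Continuity of the metric bounds the tangent-bundle trivialization at `x₀` near `x₀`, and the
chart differential is that trivialization. -/
lemma exists_norm_mfderiv_extChartAt_le (g : RiemMetric E Q) (x₀ : Q) :
    ∃ C : ℝ, ∀ᶠ x in 𝓝 x₀, ∀ v : TangentSpace 𝓘(ℝ, E) x, RiemSq g x v ≤ 1 →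
      ‖chartDifferential 𝓘(ℝ, E) x₀ x v‖ ≤ C := by
  let _ : RiemannianBundle (TangentSpace 𝓘(ℝ, E) : Q → Type _) := ⟨g.toRiemannianMetric⟩
  have _ : IsContinuousRiemannianBundle E (TangentSpace 𝓘(ℝ, E) : Q → Type _) :=
    ⟨g.inner, g.contMDiff.continuous, fun _ _ _ => rfl⟩
  obtain ⟨C, hC0, hC⟩ := eventually_norm_trivializationAt_lt E
    (TangentSpace 𝓘(ℝ, E) : Q → Type _) x₀
  refine ⟨C, ?_⟩
  filter_upwards [hC, chart_source_mem_nhds E x₀] with y hy hys v hv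
  rw [chartDifferential, ← TangentBundle.continuousLinearMapAt_trivializationAt hys]
  have hv1 : ‖v‖ ≤ 1 := by
    have : ‖v‖ ^ 2 = RiemSq g y v := (real_inner_self_eq_norm_sq v).symm
    rw [← sq_le_one_iff₀ (norm_nonneg _), this]
    exact hv
  calc _ ≤ ‖(trivializationAt E (TangentSpace 𝓘(ℝ, E) : Q → Type _) x₀).continuousLinearMapAt ℝ y‖
        * ‖v‖ := ContinuousLinearMap.le_opNorm _ _
    _ ≤ C * 1 := mul_le_mul hy.le hv1 (norm_nonneg _) hC0.le
    _ = C := mul_one C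

lemma exists_norm_mfderiv_extChartAt_prod_le (g : RiemMetric E Q) (h : RiemMetric F U)
    (x₀ : Q × U) :
    ∃ C : ℝ, ∀ᶠ x in 𝓝 x₀, ∀ v : TangentSpace (𝓘(ℝ, E).prod 𝓘(ℝ, F)) x,
      RiemSqProd g h x v ≤ 1 →
      ‖chartDifferential (𝓘(ℝ, E).prod 𝓘(ℝ, F)) x₀ x v‖ ≤ C := by
  obtain ⟨C, hC⟩ := exists_norm_mfderiv_extChartAt_le g x₀.1
  obtain ⟨D, hD⟩ := exists_norm_mfderiv_extChartAt_le h x₀.2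
  refine ⟨max C D, ?_⟩
  have h1 := (continuous_fst.tendsto x₀).eventually (hC.and (chart_source_mem_nhds E x₀.1))
  have h2 := (continuous_snd.tendsto x₀).eventually (hD.and (chart_source_mem_nhds F x₀.2))
  filter_upwards [h1, h2] with x hx1 hx2 v hv
  have hv' : RiemSq g x.1 v.1 + RiemSq h x.2 v.2 ≤ 1 := hv
  have hm : chartDifferential (𝓘(ℝ, E).prod 𝓘(ℝ, F)) x₀ x v =
      (chartDifferential 𝓘(ℝ, E) x₀.1 x.1 v.1, chartDifferential 𝓘(ℝ, F) x₀.2 x.2 v.2) := by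
    rw [chartDifferential, modelWithCornersSelf_prod, ← chartedSpaceSelf_prod, extChartAt_prod]
    have := mfderiv_prodMap (I := 𝓘(ℝ, E)) (I' := 𝓘(ℝ, F)) (J := 𝓘(ℝ, E)) (J' := 𝓘(ℝ, F))
      (p := x) (mdifferentiableAt_extChartAt hx1.2) (mdifferentiableAt_extChartAt hx2.2)
    exact congrArg (fun L => L v) this
  rw [hm]
  exact max_le_max
    (hx1.1 _ (by linarith [RiemSq_nonneg h x.2 v.2])) (hx2.1 _ (by linarith [RiemSq_nonneg g x.1 v.1]))

end RiemannianBounds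

/-! ### Local Lipschitz functions, in vector spaces and in charts. -/

section LipschitzNear

variable {X Y : Type*} [PseudoEMetricSpace X] [PseudoEMetricSpace Y]

/-- `f` is Lipschitz on a neighbourhood of `x`. -/
def LipschitzNear (f : X → ℝ) (x : X) : Prop := ∃ K, ∃ T ∈ 𝓝 x, LipschitzOnWith K f T

lemma LipschitzNear.add {f g : X → ℝ} {x : X} (hf : LipschitzNear f x) (hg : LipschitzNear g x) :
    LipschitzNear (fun y => f y + g y) x := by
  obtain ⟨K, T, hT, hK⟩ := hf
  obtain ⟨L, S, hS, hL⟩ := hg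
  exact ⟨K + L, T ∩ S, inter_mem hT hS, (hK.mono inter_subset_left).add (hL.mono inter_subset_right)⟩

lemma lipschitzNear_const (c : ℝ) (x : X) : LipschitzNear (fun _ : X => c) x :=
  ⟨0, univ, univ_mem, (LipschitzWith.const c).lipschitzOnWith⟩

lemma LipschitzNear.sum {ι : Type*} (s : Finset ι) {f : ι → X → ℝ} {x : X}
    (hf : ∀ i ∈ s, LipschitzNear (f i) x) : LipschitzNear (fun y => ∑ i ∈ s, f i y) x := by
  classical
  induction s using Finset.induction_on with
  | empty => simpa using lipschitzNear_const 0 x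
  | insert i s hi ih =>
    simp only [Finset.sum_insert hi]
    exact (hf i (Finset.mem_insert_self _ _)).add
      (ih fun j hj => hf j (Finset.mem_insert_of_mem hj))

lemma LipschitzNear.comp {f : Y → ℝ} {h : X → Y} {x : X} {K : NNReal} {T : Set X}
    (hf : LipschitzNear f (h x)) (hT : T ∈ 𝓝 x) (hh : LipschitzOnWith K h T) :
    LipschitzNear (fun y => f (h y)) x := by
  obtain ⟨L, S, hS, hL⟩ := hf
  have hcont : ContinuousAt h x := hh.continuousOn.continuousAt hT
  exact ⟨L * K, T ∩ h ⁻¹' S, inter_mem hT (hcont hS),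
    hL.comp (hh.mono inter_subset_left) fun y hy => hy.2⟩

lemma LipschitzNear.continuousAt {f : X → ℝ} {x : X} (hf : LipschitzNear f x) :
    ContinuousAt f x := by
  obtain ⟨K, T, hT, hK⟩ := hf
  exact hK.continuousOn.continuousAt hT

lemma LipschitzNear.congr {f g : X → ℝ} {x : X} (hf : LipschitzNear f x) (h : f =ᶠ[𝓝 x] g) :
    LipschitzNear g x := by
  obtain ⟨K, T, hT, hK⟩ := hf
  refine ⟨K, T ∩ {y | f y = g y}, inter_mem hT h, fun y hy z hz => ?_⟩
  have hy2 : f y = g y := hy.2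
  have hz2 : f z = g z := hz.2
  rw [← hy2, ← hz2]
  exact hK hy.1 hz.1

end LipschitzNear

section LipschitzCharts

variable {E : Type*} [NormedAddCommGroup E] [NormedSpace ℝ E]
  {H : Type*} [TopologicalSpace H] {I : ModelWithCorners ℝ E H} [I.Boundaryless]
  {M : Type*} [TopologicalSpace M] [ChartedSpace H M] [IsManifold I ∞ M]

/-- The chart in the hypothesis need not be the preferred one, but the transition between them is
`C¹`, hence locally Lipschitz. -/
lemma LocallyLipschitzInCharts.lipschitzNear {f : M → ℝ} (hf : LocallyLipschitzInCharts I f)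
    (x₀ : M) : LipschitzNear (fun z => f ((extChartAt I x₀).symm z)) (extChartAt I x₀ x₀) := by
  obtain ⟨e, he, hx, K, hK⟩ := hf x₀
  set c := extChartAt I x₀
  have hx0 : c.symm (c x₀) = x₀ := extChartAt_to_inv x₀
  have hsymm : ContMDiffAt 𝓘(ℝ, E) I 1 c.symm (c x₀) :=
    ((contMDiffOn_extChartAt_symm (n := ∞) x₀).contMDiffAt (extChartAt_target_mem_nhds x₀)).of_le (by simp)
  have hext : ContMDiffAt I 𝓘(ℝ, E) 1 (e.extend I) (c.symm (c x₀)) := by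
    rw [hx0]
    exact ((e.contMDiffOn_extend he).contMDiffAt (e.open_source.mem_nhds hx)).of_le (by simp)
  have ht : ContDiffAt ℝ 1 (fun z => e.extend I (c.symm z)) (c x₀) :=
    contMDiffAt_iff_contDiffAt.1 (hext.comp _ hsymm)
  obtain ⟨L, T, hT, hL⟩ := ht.exists_lipschitzOnWith
  have htarget : (e.extend I).target ∈ 𝓝 (e.extend I (c.symm (c x₀))) := by
    rw [hx0]
    exact (e.isOpen_extend_target).mem_nhds ((e.extend I).map_source (by rwa [e.extend_source]))
  have hnear : LipschitzNear (f ∘ (e.extend I).symm) (e.extend I (c.symm (c x₀))) :=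
    ⟨K, _, htarget, hK⟩
  refine (hnear.comp (h := fun z => e.extend I (c.symm z)) hT hL).congr ?_
  have hsrc : ∀ᶠ z in 𝓝 (c x₀), c.symm z ∈ e.source := by
    refine hsymm.continuousAt.eventually (e.open_source.mem_nhds ?_)
    rwa [hx0]
  filter_upwards [hsrc] with z hz
  simp only [Function.comp_apply]
  rw [e.extend_left_inv hz]

lemma LocallyLipschitzInCharts.continuous {f : M → ℝ} (hf : LocallyLipschitzInCharts I f) :
    Continuous f := by
  refine continuous_iff_continuousAt.2 fun x => ?_
  have h1 := (hf.lipschitzNear x).continuousAt.comp (continuousAt_extChartAt (I := I) x)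
  refine h1.congr ?_
  filter_upwards [extChartAt_source_mem_nhds (I := I) x] with y hy
  simp only [Function.comp_apply, (extChartAt I x).left_inv hy]

end LipschitzCharts

/-! ### Splitting subgradients of separable sums and normals to products. -/

section Slices

variable {Z W : Type*} [NormedAddCommGroup Z] [NormedSpace ℝ Z] [NormedAddCommGroup W]
  [NormedSpace ℝ W]

/-- Along `h`, the functions `F` and `f` differ by a constant, so composing the test function with
`h` keeps the local minimum. -/
lemma IsFrechetSubgradient.slice {F : Z → ℝ} {z : Z} {A : Z →L[ℝ] ℝ}
    (hA : IsFrechetSubgradient F z A) {f : W → ℝ} {w : W} {h : W → Z} {h' : W →L[ℝ] Z}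
    (hh : ContDiffAt ℝ 1 h w) (hh' : HasFDerivAt h h' w) (hw : h w = z)
    (hf : ∀ y, F (h y) - F z = f y - f w) : IsFrechetSubgradient f w (A.comp h') := by
  subst hw
  obtain ⟨g, hg, hgA, hmin⟩ := hA
  refine ⟨g ∘ h, hg.comp w hh, hgA.comp w hh', ?_⟩
  filter_upwards [hh.continuousAt.eventually hmin] with y hy
  have := hf y
  simp only [Function.comp_apply] at hy ⊢
  linarith

lemma IsFrechetSubgradient.fst {f : Z → ℝ} {g : W → ℝ} {z : Z × W} {A : Z × W →L[ℝ] ℝ}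
    (hA : IsFrechetSubgradient (fun z => f z.1 + g z.2) z A) :
    IsFrechetSubgradient f z.1 (A.comp (ContinuousLinearMap.inl ℝ Z W)) :=
  hA.slice (h := fun y => (y, z.2)) (contDiffAt_id.prodMk contDiffAt_const)
    (hasFDerivAt_prodMk_left z.1 z.2) rfl fun y => by simp

lemma IsFrechetSubgradient.snd {f : Z → ℝ} {g : W → ℝ} {z : Z × W} {A : Z × W →L[ℝ] ℝ}
    (hA : IsFrechetSubgradient (fun z => f z.1 + g z.2) z A) :
    IsFrechetSubgradient g z.2 (A.comp (ContinuousLinearMap.inr ℝ Z W)) :=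
  hA.slice (h := fun y => (z.1, y)) (contDiffAt_const.prodMk contDiffAt_id)
    (hasFDerivAt_prodMk_right z.1 z.2) rfl fun y => by simp

variable {ι : Type*} [Fintype ι] [DecidableEq ι] {X : ι → Type*} [∀ i, NormedAddCommGroup (X i)]
  [∀ i, NormedSpace ℝ (X i)]

omit [Fintype ι] in
lemma hasFDerivAt_update_single (x : ∀ i, X i) (i : ι) (y : X i) :
    HasFDerivAt (Function.update x i) (ContinuousLinearMap.single ℝ X i) y := by
  refine (hasFDerivAt_update x y).congr_fderiv ?_
  ext v j
  rcases eq_or_ne j i with rfl | h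
  · simp
  · simp [h]

lemma IsFrechetSubgradient.pi {f : ∀ i, X i → ℝ} {z : ∀ i, X i} {A : (∀ i, X i) →L[ℝ] ℝ}
    (hA : IsFrechetSubgradient (fun z => ∑ i, f i (z i)) z A) (i : ι) :
    IsFrechetSubgradient (f i) (z i) (A.comp (ContinuousLinearMap.single ℝ X i)) := by
  refine hA.slice (h := Function.update z i) (contDiff_update 1 z i).contDiffAt
    (hasFDerivAt_update_single z i (z i)) (Function.update_eq_self i z) fun y => ?_
  rw [← Finset.sum_sub_distrib, Finset.sum_eq_single i]
  · simp
  · intro j _ hj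
    simp [hj]
  · simp

lemma IsFrechetNormal.pi {S : ∀ i, Set (X i)} {c : ∀ i, X i} {B : (∀ i, X i) →L[ℝ] ℝ}
    (hB : IsFrechetNormal (Set.univ.pi S) c B) (i : ι) :
    IsFrechetNormal (S i) (c i) (B.comp (ContinuousLinearMap.single ℝ X i)) := by
  obtain ⟨hc, s, hs, hsB, hmax⟩ := hB
  have h0 : Function.update c i (c i) = c := Function.update_eq_self i c
  have hu := (contDiff_update (𝕜 := ℝ) 1 c i).contDiffAt (x := c i)
  refine ⟨hc i trivial, s ∘ Function.update c i, ?_, ?_, ?_⟩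
  · exact ContDiffAt.comp _ (by rwa [h0]) hu
  · exact HasFDerivAt.comp _ (by rwa [h0]) (hasFDerivAt_update_single c i (c i))
  · have hcont : Tendsto (Function.update c i) (𝓝 (c i)) (𝓝 c) := by
      simpa only [h0] using hu.continuousAt.tendsto
    refine eventually_nhdsWithin_iff.2 ?_
    filter_upwards [hcont.eventually (eventually_nhdsWithin_iff.1 hmax)] with y hy hyS
    simp only [Function.comp_apply, h0]
    refine hy fun j _ => ?_
    rcases eq_or_ne j i with rfl | hj
    · simpa using hyS
    · simpa [hj] using hc j trivial

end Slices

/-! ### Linearisation of the states and the cost. -/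

section PairChainRule

variable {V : Type*} [NormedAddCommGroup V] [NormedSpace ℝ V]
  {E : Type*} [NormedAddCommGroup E] [NormedSpace ℝ E]
  {Q : Type*} [TopologicalSpace Q] [ChartedSpace E Q] [IsManifold 𝓘(ℝ, E) ∞ Q]
  {E' : Type*} [NormedAddCommGroup E'] [NormedSpace ℝ E']
  {U : Type*} [TopologicalSpace U] [ChartedSpace E' U] [IsManifold 𝓘(ℝ, E') ∞ U]
  {E'' : Type*} [NormedAddCommGroup E''] [NormedSpace ℝ E'']
  {N : Type*} [TopologicalSpace N] [ChartedSpace E'' N] [IsManifold 𝓘(ℝ, E'') ∞ N]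

/-- The partial differential in the first variable. -/
noncomputable def partialFst (F : Q × U → N) (q : Q) (u : U) : E →L[ℝ] E'' :=
  mfderiv 𝓘(ℝ, E) 𝓘(ℝ, E'') (fun r => F (r, u)) q

/-- The partial differential in the second variable. -/
noncomputable def partialSnd (F : Q × U → N) (q : Q) (u : U) : E' →L[ℝ] E'' :=
  mfderiv 𝓘(ℝ, E') 𝓘(ℝ, E'') (fun c => F (q, c)) u

omit [IsManifold 𝓘(ℝ, E) ∞ Q] [IsManifold 𝓘(ℝ, E') ∞ U] [IsManifold 𝓘(ℝ, E'') ∞ N] in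
lemma hasMFDerivAt_comp_pair {F : Q × U → N} {X : V → Q} {Y : V → U} {c : V} {q : Q} {u : U}
    (hq : X c = q) (hu : Y c = u)
    (hF : MDifferentiableAt (𝓘(ℝ, E).prod 𝓘(ℝ, E')) 𝓘(ℝ, E'') F (q, u))
    {ξ : V →L[ℝ] E} {η : V →L[ℝ] E'} (hX : HasMFDerivAt 𝓘(ℝ, V) 𝓘(ℝ, E) X c ξ)
    (hY : HasMFDerivAt 𝓘(ℝ, V) 𝓘(ℝ, E') Y c η) :
    HasMFDerivAt 𝓘(ℝ, V) 𝓘(ℝ, E'') (fun c => F (X c, Y c)) c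
      ((partialFst F q u).comp ξ + (partialSnd F q u).comp η : V →L[ℝ] E'') := by
  subst hq hu
  have h1 := HasMFDerivAt.comp c hF.hasMFDerivAt (hX.prodMk hY)
  refine h1.congr_mfderiv ?_
  ext v
  exact mfderiv_prod_eq_add_apply hF

end PairChainRule

section ChartControls

variable {n : ℕ} {E : Type*} [NormedAddCommGroup E] [NormedSpace ℝ E]
  {Q : Type*} [TopologicalSpace Q] [ChartedSpace E Q] [IsManifold 𝓘(ℝ, E) ∞ Q]
  {EU : Fin n → Type*} [∀ i, NormedAddCommGroup (EU i)] [∀ i, NormedSpace ℝ (EU i)]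
  {U : Fin n → Type*} [∀ i, TopologicalSpace (U i)]
  [∀ i, ChartedSpace (EU i) (U i)] [∀ i, IsManifold 𝓘(ℝ, EU i) ∞ (U i)]

/-- Controls with coordinates `c` in the charts around `u`. -/
noncomputable def chartControls (u : ∀ i, U i) (c : ∀ i, EU i) : ∀ i, U i :=
  fun i => (extChartAt 𝓘(ℝ, EU i) (u i)).symm (c i)

variable (EU) in
/-- The coordinates of `u` in the charts around `u`. -/
noncomputable def chartPoint (u : ∀ i, U i) : ∀ i, EU i :=
  fun i => extChartAt 𝓘(ℝ, EU i) (u i) (u i)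

omit [∀ i, IsManifold 𝓘(ℝ, EU i) ∞ (U i)] in
@[simp] lemma chartControls_chartPoint (u : ∀ i, U i) : chartControls u (chartPoint EU u) = u :=
  funext fun i => extChartAt_to_inv (u i)

lemma contMDiffAt_chartControls (u : ∀ i, U i) (i : Fin n) :
    ContMDiffAt 𝓘(ℝ, ∀ i, EU i) 𝓘(ℝ, EU i) 1 (fun c => chartControls u c i) (chartPoint EU u) := by
  have h1 : ContMDiffAt 𝓘(ℝ, EU i) 𝓘(ℝ, EU i) 1 (extChartAt 𝓘(ℝ, EU i) (u i)).symm
      (extChartAt 𝓘(ℝ, EU i) (u i) (u i)) :=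
    ((contMDiffOn_extChartAt_symm (n := ∞) (u i)).contMDiffAt
      (extChartAt_target_mem_nhds (u i))).of_le (by simp)
  have h2 : ContMDiffAt 𝓘(ℝ, ∀ i, EU i) 𝓘(ℝ, EU i) 1 (fun c : ∀ i, EU i => c i)
      (chartPoint EU u) := 
      (ContinuousLinearMap.proj (R := ℝ) (φ := EU) i).contDiff.contMDiff.contMDiffAt
  exact h1.comp (chartPoint EU u) h2

/-- The manifold derivative is computed in the chart at the image point `u i`, where the chart
cancels its inverse and leaves the coordinate projection. -/
lemma hasMFDerivAt_chartControls (u : ∀ i, U i) (i : Fin n) :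
    HasMFDerivAt 𝓘(ℝ, ∀ i, EU i) 𝓘(ℝ, EU i) (fun c => chartControls u c i) (chartPoint EU u)
      (ContinuousLinearMap.proj (R := ℝ) (φ := EU) i) := by
  refine ⟨(contMDiffAt_chartControls u i).continuousAt, ?_⟩
  have h1 : HasFDerivAt (fun c : ∀ i, EU i => c i) (ContinuousLinearMap.proj (R := ℝ) (φ := EU) i)
    (chartPoint EU u) :=
    (ContinuousLinearMap.proj (R := ℝ) (φ := EU) i).hasFDerivAt
  refine (h1.congr_of_eventuallyEq ?_).hasFDerivWithinAt
  have h2 : Tendsto (fun c : ∀ i, EU i => c i) (𝓝 (chartPoint EU u)) (𝓝 (chartPoint EU u i)) :=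
    (continuous_apply i).tendsto _
  filter_upwards [h2.eventually (extChartAt_target_mem_nhds (I := 𝓘(ℝ, EU i)) (u i))] with c hc
  have h3 : chartControls u (chartPoint EU u) i = u i := by rw [chartControls_chartPoint]
  change extChartAt 𝓘(ℝ, EU i) (chartControls u (chartPoint EU u) i) (chartControls u c i) = c i
  rw [h3]
  exact (extChartAt 𝓘(ℝ, EU i) (u i)).right_inv hc

variable (F : ∀ i, Q × U i → Q) (q₀ : Q)

variable {F} (hF : ∀ i, ContMDiff (𝓘(ℝ, E).prod 𝓘(ℝ, EU i)) 𝓘(ℝ, E) 1 (F i))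
include hF

omit [IsManifold 𝓘(ℝ, E) ∞ Q] in
lemma contMDiffAt_stateSeq (u : ∀ i, U i) (j : Fin (n + 1)) :
    ContMDiffAt 𝓘(ℝ, ∀ i, EU i) 𝓘(ℝ, E) 1 (fun c => stateSeq F q₀ (chartControls u c) j)
      (chartPoint EU u) := by
  induction j using Fin.induction with
  | zero => exact contMDiffAt_const
  | succ i ih =>
    exact (hF i).contMDiffAt.comp (chartPoint EU u) (ih.prodMk (contMDiffAt_chartControls u i))

variable (E EU) in
/-- The linearised states. -/
noncomputable def stateDeriv (F : ∀ i, Q × U i → Q) (q₀ : Q) (u : ∀ i, U i) (j : Fin (n + 1)) :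
    (∀ i, EU i) →L[ℝ] E :=
  mfderiv 𝓘(ℝ, ∀ i, EU i) 𝓘(ℝ, E) (fun c => stateSeq F q₀ (chartControls u c) j) (chartPoint EU u)

omit [IsManifold 𝓘(ℝ, E) ∞ Q] in
lemma hasMFDerivAt_stateSeq (u : ∀ i, U i) (j : Fin (n + 1)) :
    HasMFDerivAt 𝓘(ℝ, ∀ i, EU i) 𝓘(ℝ, E) (fun c => stateSeq F q₀ (chartControls u c) j)
      (chartPoint EU u) (stateDeriv E EU F q₀ u j : (∀ i, EU i) →L[ℝ] E) :=
  ((contMDiffAt_stateSeq q₀ hF u j).mdifferentiableAt one_ne_zero).hasMFDerivAt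

omit hF in
omit [IsManifold 𝓘(ℝ, E) ∞ Q] [∀ (i : Fin n), IsManifold 𝓘(ℝ, EU i) ∞ (U i)] in
lemma stateDeriv_zero (u : ∀ i, U i) : stateDeriv E EU F q₀ u 0 = 0 :=
  mfderiv_const

omit [IsManifold 𝓘(ℝ, E) ∞ Q] in
lemma hasMFDerivAt_running {E'' : Type*} [NormedAddCommGroup E''] [NormedSpace ℝ E'']
    {N : Type*} [TopologicalSpace N] [ChartedSpace E'' N] [IsManifold 𝓘(ℝ, E'') ∞ N]
    (u : ∀ i, U i) (i : Fin n) {L : Q × U i → N}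
    (hL : ContMDiff (𝓘(ℝ, E).prod 𝓘(ℝ, EU i)) 𝓘(ℝ, E'') 1 L) :
    HasMFDerivAt 𝓘(ℝ, ∀ i, EU i) 𝓘(ℝ, E'')
      (fun c => L (stateSeq F q₀ (chartControls u c) i.castSucc, chartControls u c i))
      (chartPoint EU u)
      ((partialFst L (stateSeq F q₀ u i.castSucc) (u i)).comp (stateDeriv E EU F q₀ u i.castSucc) +
        (partialSnd L (stateSeq F q₀ u i.castSucc) (u i)).comp
          (ContinuousLinearMap.proj (R := ℝ) (φ := EU) i) : (∀ i, EU i) →L[ℝ] E'') :=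
  hasMFDerivAt_comp_pair (by rw [chartControls_chartPoint]) (by rw [chartControls_chartPoint])
    (hL.mdifferentiable one_ne_zero _) (hasMFDerivAt_stateSeq q₀ hF u _)
    (hasMFDerivAt_chartControls u i)

lemma stateDeriv_succ (u : ∀ i, U i) (i : Fin n) (v : ∀ i, EU i) :
    stateDeriv E EU F q₀ u i.succ v =
      partialFst (F i) (stateSeq F q₀ u i.castSucc) (u i) (stateDeriv E EU F q₀ u i.castSucc v) +
        partialSnd (F i) (stateSeq F q₀ u i.castSucc) (u i) (v i) :=
  congrArg (fun T : (∀ i, EU i) →L[ℝ] E => T v) (hasMFDerivAt_running q₀ hF u i (hF i)).mfderiv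

-- By definition the manifold derivative is the derivative in the chart at the image point, so
-- `stateDeriv` is already the derivative of the states in coordinates.
omit [IsManifold 𝓘(ℝ, E) ∞ Q] in
lemma hasFDerivAt_chart_stateSeq (u : ∀ i, U i) (j : Fin (n + 1)) :
    HasFDerivAt (fun c => extChartAt 𝓘(ℝ, E) (stateSeq F q₀ u j)
      (stateSeq F q₀ (chartControls u c) j)) (stateDeriv E EU F q₀ u j : (∀ i, EU i) →L[ℝ] E)
      (chartPoint EU u) := by
  have h := (hasMFDerivAt_stateSeq q₀ hF u j).2
  have h1 : stateSeq F q₀ (chartControls u (chartPoint EU u)) j = stateSeq F q₀ u j := by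
    rw [chartControls_chartPoint]
  change HasFDerivWithinAt (fun c => extChartAt 𝓘(ℝ, E)
    (stateSeq F q₀ (chartControls u (chartPoint EU u)) j) (stateSeq F q₀ (chartControls u c) j))
    _ (range 𝓘(ℝ, ∀ i, EU i)) _ at h
  rw [h1] at h
  rw [modelWithCornersSelf_coe, range_id] at h
  exact hasFDerivWithinAt_univ.1 h

omit [IsManifold 𝓘(ℝ, E) ∞ Q] in
lemma contDiffAt_chart_stateSeq (u : ∀ i, U i) (j : Fin (n + 1)) :
    ContDiffAt ℝ 1 (fun c => extChartAt 𝓘(ℝ, E) (stateSeq F q₀ u j)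
      (stateSeq F q₀ (chartControls u c) j)) (chartPoint EU u) := by
  refine contMDiffAt_iff_contDiffAt.1 (ContMDiffAt.comp (chartPoint EU u) ?_
    (contMDiffAt_stateSeq q₀ hF u j))
  rw [chartControls_chartPoint]
  exact contMDiffAt_extChartAt

variable {ℓ : Q → ℝ} {L : ∀ i, Q × U i → ℝ}
  (hℓ : ContMDiff 𝓘(ℝ, E) 𝓘(ℝ, ℝ) 1 ℓ)
  (hL : ∀ i, ContMDiff (𝓘(ℝ, E).prod 𝓘(ℝ, EU i)) 𝓘(ℝ, ℝ) 1 (L i))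
include hℓ hL

omit [IsManifold 𝓘(ℝ, E) ∞ Q] in
lemma contDiffAt_cost (u : ∀ i, U i) :
    ContDiffAt ℝ 1 (fun c => cost F q₀ ℓ L (chartControls u c)) (chartPoint EU u) := by
  refine ContDiffAt.add ?_ (ContDiffAt.sum fun i _ => ?_)
  · exact contMDiffAt_iff_contDiffAt.1
      (hℓ.contMDiffAt.comp (chartPoint EU u) (contMDiffAt_stateSeq q₀ hF u _))
  · exact contMDiffAt_iff_contDiffAt.1 ((hL i).contMDiffAt.comp (chartPoint EU u)
      ((contMDiffAt_stateSeq q₀ hF u _).prodMk (contMDiffAt_chartControls u i)))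

omit [IsManifold 𝓘(ℝ, E) ∞ Q] in
lemma fderiv_cost (u : ∀ i, U i) (v : ∀ i, EU i) :
    fderiv ℝ (fun c => cost F q₀ ℓ L (chartControls u c)) (chartPoint EU u) v =
      differential 𝓘(ℝ, E) ℓ (stateSeq F q₀ u (Fin.last n)) (stateDeriv E EU F q₀ u (Fin.last n) v) +
      ∑ i, (partialFst (L i) (stateSeq F q₀ u i.castSucc) (u i)
          (stateDeriv E EU F q₀ u i.castSucc v) +
        partialSnd (L i) (stateSeq F q₀ u i.castSucc) (u i) (v i)) := by
  have h1 : HasFDerivAt (fun c => ℓ (stateSeq F q₀ (chartControls u c) (Fin.last n)))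
      ((differential 𝓘(ℝ, E) ℓ (stateSeq F q₀ u (Fin.last n)) : E →L[ℝ] ℝ).comp
        (stateDeriv E EU F q₀ u (Fin.last n))) (chartPoint EU u) := by
    refine hasMFDerivAt_iff_hasFDerivAt.1 (HasMFDerivAt.comp (chartPoint EU u) ?_
      (hasMFDerivAt_stateSeq q₀ hF u (Fin.last n)))
    rw [chartControls_chartPoint]
    exact (hℓ.mdifferentiable one_ne_zero _).hasMFDerivAt
  have h2 := h1.add (HasFDerivAt.fun_sum (u := Finset.univ) fun i _ =>
    (hasMFDerivAt_running q₀ hF u i (hL i)).hasFDerivAt)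
  have h3 := congrArg (fun T : (∀ i, EU i) →L[ℝ] ℝ => T v) h2.fderiv
  simpa using! h3

end ChartControls

/-! ### Telescoping and backward recursion. -/

section Costates

lemma Fin.sum_succ_sub_castSucc {n : ℕ} (P : Fin (n + 1) → ℝ) :
    ∑ i : Fin n, (P i.succ - P i.castSucc) = P (Fin.last n) - P 0 := by
  have h1 := Fin.sum_univ_castSucc P
  have h2 := Fin.sum_univ_succ P
  rw [Finset.sum_sub_distrib]
  linarith

lemma Fin.exists_backward_recursion {n : ℕ} {α : Type*} (a : α) (g : Fin n → α → α) :
    ∃ p : Fin (n + 1) → α, p (Fin.last n) = a ∧ ∀ i : Fin n, p i.castSucc = g i (p i.succ) :=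
  ⟨Fin.reverseInduction (motive := fun _ => α) a fun i => g i,
    Fin.reverseInduction_last, fun i => Fin.reverseInduction_castSucc i⟩

end Costates

/-! ### The constraints and the trajectory in charts. -/

section ConstraintsInCharts

variable {n : ℕ} {E : Type*} [NormedAddCommGroup E] [NormedSpace ℝ E]
  {Q : Type*} [TopologicalSpace Q] [ChartedSpace E Q] [IsManifold 𝓘(ℝ, E) ∞ Q]
  {EU : Fin n → Type*} [∀ i, NormedAddCommGroup (EU i)] [∀ i, NormedSpace ℝ (EU i)]
  {U : Fin n → Type*} [∀ i, TopologicalSpace (U i)]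
  [∀ i, ChartedSpace (EU i) (U i)] [∀ i, IsManifold 𝓘(ℝ, EU i) ∞ (U i)]

/-- The mixed constraint with index `i ≥ 1` in the chart around `(q i, u i)`, and `0` for
`i = 0`. -/
noncomputable def mixedConstraintInChart (φ : ∀ i, Q × U i → ℝ) (q : Fin (n + 1) → Q)
    (u : ∀ i, U i) (i : Fin n) (z : E × EU i) : ℝ :=
  if 0 < (i : ℕ) then
    φ i ((extChartAt (𝓘(ℝ, E).prod 𝓘(ℝ, EU i)) (q i.castSucc, u i)).symm z) else 0

/-- The sum of all constraints, in charts. -/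
noncomputable def constraintInChart (φ : ∀ i, Q × U i → ℝ) (ψ : Q → ℝ) (q : Fin (n + 1) → Q)
    (u : ∀ i, U i) (z : (∀ i, E × EU i) × E) : ℝ :=
  ∑ i, mixedConstraintInChart φ q u i (z.1 i) +
    ψ ((extChartAt 𝓘(ℝ, E) (q (Fin.last n))).symm z.2)

/-- The trajectory generated by the controls with coordinates `c`, in charts. -/
noncomputable def trajectoryInChart (F : ∀ i, Q × U i → Q) (q₀ : Q) (u : ∀ i, U i)
    (c : ∀ i, EU i) : (∀ i, E × EU i) × E :=
  (fun i => (extChartAt 𝓘(ℝ, E) (stateSeq F q₀ u i.castSucc)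
      (stateSeq F q₀ (chartControls u c) i.castSucc), c i),
    extChartAt 𝓘(ℝ, E) (stateSeq F q₀ u (Fin.last n))
      (stateSeq F q₀ (chartControls u c) (Fin.last n)))

omit [IsManifold 𝓘(ℝ, E) ∞ Q] [∀ (i : Fin n), IsManifold 𝓘(ℝ, EU i) ∞ (U i)] in
lemma mixedConstraintInChart_nonneg {φ : ∀ i, Q × U i → ℝ}
    (hφ : ∀ i : Fin n, 0 < (i : ℕ) → ∀ x, 0 ≤ φ i x) (q : Fin (n + 1) → Q) (u : ∀ i, U i)
    (i : Fin n) (z : E × EU i) : 0 ≤ mixedConstraintInChart φ q u i z := by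
  unfold mixedConstraintInChart
  split_ifs with h
  · exact hφ i h _
  · exact le_rfl

omit [IsManifold 𝓘(ℝ, E) ∞ Q] [∀ (i : Fin n), IsManifold 𝓘(ℝ, EU i) ∞ (U i)] in
lemma constraintInChart_nonneg {φ : ∀ i, Q × U i → ℝ} {ψ : Q → ℝ}
    (hφ : ∀ i : Fin n, 0 < (i : ℕ) → ∀ x, 0 ≤ φ i x) (hψ : ∀ x, 0 ≤ ψ x) (q : Fin (n + 1) → Q)
    (u : ∀ i, U i) (z : (∀ i, E × EU i) × E) : 0 ≤ constraintInChart φ ψ q u z :=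
  add_nonneg (Finset.sum_nonneg fun i _ => mixedConstraintInChart_nonneg hφ q u i _) (hψ _)

lemma lipschitzNear_constraintInChart {φ : ∀ i, Q × U i → ℝ} {ψ : Q → ℝ}
    (hφ : ∀ i : Fin n, 0 < (i : ℕ) → LocallyLipschitzInCharts (𝓘(ℝ, E).prod 𝓘(ℝ, EU i)) (φ i))
    (hψ : LocallyLipschitzInCharts 𝓘(ℝ, E) ψ) (q : Fin (n + 1) → Q) (u : ∀ i, U i)
    {z : (∀ i, E × EU i) × E}
    (hz : ∀ i : Fin n,
      z.1 i = extChartAt (𝓘(ℝ, E).prod 𝓘(ℝ, EU i)) (q i.castSucc, u i) (q i.castSucc, u i))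
    (hz' : z.2 = extChartAt 𝓘(ℝ, E) (q (Fin.last n)) (q (Fin.last n))) :
    LipschitzNear (constraintInChart φ ψ q u) z := by
  have h1 : ∀ i, LipschitzNear (fun z : (∀ i, E × EU i) × E =>
      mixedConstraintInChart φ q u i (z.1 i)) z := fun i => by
    have h2 : LipschitzNear (mixedConstraintInChart (E := E) (EU := EU) φ q u i) (z.1 i) := by
      rw [hz]
      by_cases h : 0 < (i : ℕ)
      · refine ((hφ i h).lipschitzNear (q i.castSucc, u i)).congr (.of_forall fun y => ?_)
        simp only [mixedConstraintInChart, h, if_true]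
      · refine (lipschitzNear_const 0 _).congr (.of_forall fun y => ?_)
        simp only [mixedConstraintInChart, h, if_false]
    have h3 : LipschitzWith (1 * 1) fun z : (∀ i, E × EU i) × E => z.1 i :=
      (LipschitzWith.eval (α := fun i => E × EU i) i).comp LipschitzWith.prod_fst
    exact LipschitzNear.comp (h := fun z : (∀ i, E × EU i) × E => z.1 i) h2 univ_mem
      h3.lipschitzOnWith
  have h2 := hψ.lipschitzNear (q (Fin.last n))
  rw [← hz'] at h2
  exact (LipschitzNear.sum Finset.univ fun i _ => h1 i).add
    (LipschitzNear.comp (h := fun z : (∀ i, E × EU i) × E => z.2) h2 univ_mem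
      LipschitzWith.prod_snd.lipschitzOnWith)

lemma IsFrechetSubgradient.eq_zero_of_const {Z : Type*} [NormedAddCommGroup Z] [NormedSpace ℝ Z]
    {r : ℝ} {z : Z} {A : Z →L[ℝ] ℝ} (hA : IsFrechetSubgradient (fun _ => r) z A) : A = 0 := by
  obtain ⟨g, -, hgA, hmin⟩ := hA
  have := hmin.hasFDerivAt_eq_zero (hgA.const_sub r)
  simpa using this

omit [IsManifold 𝓘(ℝ, E) ∞ Q] [∀ (i : Fin n), IsManifold 𝓘(ℝ, EU i) ∞ (U i)] in
lemma constraintInChart_eq_zero_iff {φ : ∀ i, Q × U i → ℝ} {ψ : Q → ℝ}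
    (hφ : ∀ i : Fin n, 0 < (i : ℕ) → ∀ x, 0 ≤ φ i x) (hψ : ∀ x, 0 ≤ ψ x) (q : Fin (n + 1) → Q)
    (u : ∀ i, U i) (z : (∀ i, E × EU i) × E) :
    constraintInChart φ ψ q u z = 0 ↔
      (∀ i : Fin n, 0 < (i : ℕ) →
        φ i ((extChartAt (𝓘(ℝ, E).prod 𝓘(ℝ, EU i)) (q i.castSucc, u i)).symm (z.1 i)) = 0) ∧
      ψ ((extChartAt 𝓘(ℝ, E) (q (Fin.last n))).symm z.2) = 0 := by
  have hnn := mixedConstraintInChart_nonneg (EU := EU) (E := E) hφ q u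
  rw [constraintInChart, add_eq_zero_iff_of_nonneg (Finset.sum_nonneg fun i _ => hnn i _) (hψ _),
    Finset.sum_eq_zero_iff_of_nonneg fun i _ => hnn i _]
  refine and_congr_left fun _ => forall_congr' fun i => ?_
  by_cases h : 0 < (i : ℕ) <;> simp [mixedConstraintInChart, h]

variable {F : ∀ i, Q × U i → Q} (q₀ : Q)
  (hF : ∀ i, ContMDiff (𝓘(ℝ, E).prod 𝓘(ℝ, EU i)) 𝓘(ℝ, E) 1 (F i))

omit [IsManifold 𝓘(ℝ, E) ∞ Q] [∀ (i : Fin n), IsManifold 𝓘(ℝ, EU i) ∞ (U i)] in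
lemma trajectoryInChart_fst_chartPoint (F : ∀ i, Q × U i → Q) (u : ∀ i, U i) (i : Fin n) :
    (trajectoryInChart (E := E) F q₀ u (chartPoint EU u)).1 i =
      extChartAt (𝓘(ℝ, E).prod 𝓘(ℝ, EU i)) (stateSeq F q₀ u i.castSucc, u i)
        (stateSeq F q₀ u i.castSucc, u i) := by
  simp only [trajectoryInChart, chartControls_chartPoint]
  rfl

omit [IsManifold 𝓘(ℝ, E) ∞ Q] [∀ (i : Fin n), IsManifold 𝓘(ℝ, EU i) ∞ (U i)] in
lemma trajectoryInChart_snd_chartPoint (F : ∀ i, Q × U i → Q) (u : ∀ i, U i) :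
    (trajectoryInChart (E := E) F q₀ u (chartPoint EU u)).2 =
      extChartAt 𝓘(ℝ, E) (stateSeq F q₀ u (Fin.last n)) (stateSeq F q₀ u (Fin.last n)) := by
  simp only [trajectoryInChart, chartControls_chartPoint]

include hF

omit [IsManifold 𝓘(ℝ, E) ∞ Q] in
lemma contDiffAt_trajectoryInChart (u : ∀ i, U i) :
    ContDiffAt ℝ 1 (trajectoryInChart (E := E) (EU := EU) F q₀ u) (chartPoint EU u) :=
  (contDiffAt_pi.2 fun i => (contDiffAt_chart_stateSeq q₀ hF u _).prodMk
    (ContinuousLinearMap.proj (R := ℝ) (φ := EU) i).contDiff.contDiffAt).prodMk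
    (contDiffAt_chart_stateSeq q₀ hF u _)

omit [IsManifold 𝓘(ℝ, E) ∞ Q] in
lemma fderiv_trajectoryInChart (u : ∀ i, U i) (v : ∀ i, EU i) :
    fderiv ℝ (trajectoryInChart (E := E) (EU := EU) F q₀ u) (chartPoint EU u) v =
      (fun i => (stateDeriv E EU F q₀ u i.castSucc v, v i),
        stateDeriv E EU F q₀ u (Fin.last n) v) := by
  have h1 := (hasFDerivAt_pi.2 fun i => (hasFDerivAt_chart_stateSeq q₀ hF u
    (Fin.castSucc i)).prodMk (ContinuousLinearMap.proj (R := ℝ) (φ := EU) i).hasFDerivAt).prodMk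
      (hasFDerivAt_chart_stateSeq q₀ hF u (Fin.last n))
  exact congrArg (fun T : (∀ i, EU i) →L[ℝ] (∀ i, E × EU i) × E => T v) h1.fderiv

omit [IsManifold 𝓘(ℝ, E) ∞ Q] in
/-- Near `u`, the constraint in charts is the original one. -/
lemma eventually_admissible_of_constraintInChart {φ : ∀ i, Q × U i → ℝ} {ψ : Q → ℝ}
    (hφ : ∀ i : Fin n, 0 < (i : ℕ) → ∀ x, 0 ≤ φ i x) (hψ : ∀ x, 0 ≤ ψ x) (Ω : ∀ i, Set (U i))
    (u : ∀ i, U i) :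
    ∀ᶠ c in 𝓝[univ.pi fun i => (extChartAt 𝓘(ℝ, EU i) (u i)).symm ⁻¹' Ω i] (chartPoint EU u),
      constraintInChart φ ψ (stateSeq F q₀ u) u (trajectoryInChart (E := E) F q₀ u c) = 0 →
        chartControls u c ∈ admissibleControls F q₀ Ω φ ψ := by
  -- The inverse chart undoes the chart only on its source, which contains the states of nearby
  -- controls by continuity.
  have hnear : ∀ j, ∀ᶠ c in 𝓝 (chartPoint EU u), stateSeq F q₀ (chartControls u c) j ∈
      (extChartAt 𝓘(ℝ, E) (stateSeq F q₀ u j)).source := fun j => by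
    refine (contMDiffAt_stateSeq q₀ hF u j).continuousAt.eventually ?_
    simp only [chartControls_chartPoint]
    exact extChartAt_source_mem_nhds _
  filter_upwards [nhdsWithin_le_nhds (eventually_all.2 hnear), self_mem_nhdsWithin]
    with c hc hcΩ h0
  obtain ⟨h1, h2⟩ := (constraintInChart_eq_zero_iff hφ hψ _ _ _).1 h0
  refine ⟨fun i => hcΩ i trivial, fun i hi => ?_, ?_⟩
  · have h3 : (extChartAt (𝓘(ℝ, E).prod 𝓘(ℝ, EU i)) (stateSeq F q₀ u i.castSucc, u i)).symm
        ((trajectoryInChart (E := E) F q₀ u c).1 i) =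
        (stateSeq F q₀ (chartControls u c) i.castSucc, chartControls u c i) :=
      Prod.ext ((extChartAt 𝓘(ℝ, E) _).left_inv (hc i.castSucc)) rfl
    have h4 := h1 i hi
    rwa [h3] at h4
  · have h4 := h2
    simp only [trajectoryInChart] at h4
    rwa [(extChartAt 𝓘(ℝ, E) _).left_inv (hc _)] at h4

-- The preimage under an inverse chart need not be closed, since that map is continuous only on the
-- target; intersecting with closed balls inside the targets restores closedness.
omit hF in
omit [∀ (i : Fin n), IsManifold 𝓘(ℝ, EU i) ∞ (U i)] in
lemma exists_nhds_isClosed_inter_preimage_chart [∀ i, FiniteDimensional ℝ (EU i)]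
    {Ω : ∀ i, Set (U i)} (hΩ : ∀ i, IsClosed (Ω i)) (u : ∀ i, U i) :
    ∃ s ∈ 𝓝 (chartPoint EU u),
      IsClosed (s ∩ univ.pi fun i => (extChartAt 𝓘(ℝ, EU i) (u i)).symm ⁻¹' Ω i) := by
  have h : ∀ i, ∃ r : ℝ, 0 < r ∧ Metric.closedBall (chartPoint EU u i) r ⊆
      (extChartAt 𝓘(ℝ, EU i) (u i)).target := fun i =>
    Metric.nhds_basis_closedBall.mem_iff.1 (extChartAt_target_mem_nhds (u i))
  choose r hr hrt using h
  refine ⟨univ.pi fun i => Metric.closedBall (chartPoint EU u i) (r i),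
    set_pi_mem_nhds finite_univ fun i _ => Metric.closedBall_mem_nhds _ (hr i), ?_⟩
  rw [← pi_inter_distrib]
  exact isClosed_set_pi fun i _ =>
    ((continuousOn_extChartAt_symm (u i)).mono (hrt i)).preimage_isClosed_of_isClosed
      Metric.isClosed_closedBall (hΩ i)

end ConstraintsInCharts

/-! ### Summation by parts. -/

section AdjointIdentity

/-- Summation by parts of the costates against the linearised states. -/
lemma adjoint_identity {n : ℕ} {E : Type*} [NormedAddCommGroup E] [NormedSpace ℝ E]
    {EU : Fin n → Type*} [∀ i, NormedAddCommGroup (EU i)] [∀ i, NormedSpace ℝ (EU i)]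
    {l κ : ℝ} {x : Fin (n + 1) → E} {w : ∀ i, EU i} {p : Fin (n + 1) → E →L[ℝ] ℝ}
    {Fq : Fin n → E →L[ℝ] E} {Fu : ∀ i, EU i →L[ℝ] E} {Lq : Fin n → E →L[ℝ] ℝ}
    {Lu b : ∀ i, EU i →L[ℝ] ℝ} {a : Fin n → E →L[ℝ] ℝ} {aₙ dℓ : E →L[ℝ] ℝ}
    (hx0 : x 0 = 0) (hx : ∀ i : Fin n, x i.succ = Fq i (x i.castSucc) + Fu i (w i))
    (hpn : p (Fin.last n) = -(κ • aₙ) - l • dℓ)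
    (hp : ∀ i : Fin n, p i.castSucc = -(l • Lq i) - κ • a i + (p i.succ).comp (Fq i)) :
    l * (dℓ (x (Fin.last n)) + ∑ i : Fin n, (Lq i (x i.castSucc) + Lu i (w i))) +
      κ * (∑ i : Fin n, (a i (x i.castSucc) + b i (w i)) + aₙ (x (Fin.last n))) =
      ∑ i : Fin n, (l * Lu i (w i) + κ * b i (w i) - p i.succ (Fu i (w i))) := by
  -- The pairing of costate and linearised state telescopes. In each increment the `Fq` terms
  -- cancel, and the boundary term at `0` vanishes because the initial state is fixed.
  have h1 := Fin.sum_succ_sub_castSucc fun j => p j (x j)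
  have h2 : ∀ i : Fin n, p i.succ (x i.succ) - p i.castSucc (x i.castSucc) =
      p i.succ (Fu i (w i)) + l * Lq i (x i.castSucc) + κ * a i (x i.castSucc) := fun i => by
    simp only [hx, hp, map_add, add_apply, sub_apply, neg_apply, smul_apply, smul_eq_mul,
      ContinuousLinearMap.comp_apply]
    ring
  simp only [h2, hx0, hpn, map_zero, sub_zero, sub_apply, neg_apply, smul_apply, smul_eq_mul,
    Finset.sum_add_distrib, ← Finset.mul_sum] at h1
  simp only [Finset.sum_add_distrib, Finset.sum_sub_distrib, ← Finset.mul_sum]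
  linarith

lemma ContinuousLinearMap.apply_pi_prod_eq_sum {ι : Type*} [Fintype ι] [DecidableEq ι]
    {X : ι → Type*} [∀ i, NormedAddCommGroup (X i)] [∀ i, NormedSpace ℝ (X i)] {Y : Type*}
    [NormedAddCommGroup Y] [NormedSpace ℝ Y] (A : (∀ i, X i) × Y →L[ℝ] ℝ) (x : ∀ i, X i) (y : Y) :
    A (x, y) = ∑ i, (A.comp (.inl ℝ _ Y)).comp (.single ℝ X i) (x i) +
      A.comp (.inr ℝ (∀ i, X i) Y) y := by
  have h1 : A (x, y) = A (x, 0) + A (0, y) := by rw [← map_add]; simp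
  rw [h1]
  exact congrArg (· + A (0, y)) (ContinuousLinearMap.sum_comp_single _ _ (A.comp (.inl ℝ _ Y)) x).symm

lemma Filter.Tendsto.clm_comp_const {α : Type*} {f : Filter α} {X Y : Type*}
    [NormedAddCommGroup X] [NormedSpace ℝ X] [NormedAddCommGroup Y] [NormedSpace ℝ Y]
    {A : α → Y →L[ℝ] ℝ} {A₀ : Y →L[ℝ] ℝ} (hA : Tendsto A f (𝓝 A₀)) (T : X →L[ℝ] Y) :
    Tendsto (fun k => (A k).comp T) f (𝓝 (A₀.comp T)) :=
  (continuous_id.clm_comp_const T).tendsto A₀ |>.comp hA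

end AdjointIdentity

/-! ### Assembling the multipliers and costates. -/

theorem mainTheorem8
    {n : ℕ}
    {E : Type*} [NormedAddCommGroup E] [NormedSpace ℝ E] [FiniteDimensional ℝ E]
    {Q : Type*} [TopologicalSpace Q] [T2Space Q] [ChartedSpace E Q] [IsManifold 𝓘(ℝ, E) ∞ Q]
    {EU : Fin n → Type*} [∀ i, NormedAddCommGroup (EU i)] [∀ i, NormedSpace ℝ (EU i)]
    [∀ i, FiniteDimensional ℝ (EU i)]
    {U : Fin n → Type*} [∀ i, TopologicalSpace (U i)] [∀ i, T2Space (U i)]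
    [∀ i, ChartedSpace (EU i) (U i)] [∀ i, IsManifold 𝓘(ℝ, EU i) ∞ (U i)]
    (gQ : RiemMetric E Q) (gU : ∀ i, RiemMetric (EU i) (U i))
    (F : ∀ i, Q × U i → Q) (q₀ : Q) (Ω : ∀ i, Set (U i))
    (ℓ : Q → ℝ) (L : ∀ i, Q × U i → ℝ)
    (φ : ∀ i, Q × U i → ℝ) (ψ : Q → ℝ)
    (hF : ∀ i, ContMDiff (𝓘(ℝ, E).prod 𝓘(ℝ, EU i)) 𝓘(ℝ, E) 1 (F i))
    (hℓ : ContMDiff 𝓘(ℝ, E) 𝓘(ℝ, ℝ) 1 ℓ)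
    (hL : ∀ i, ContMDiff (𝓘(ℝ, E).prod 𝓘(ℝ, EU i)) 𝓘(ℝ, ℝ) 1 (L i))
    (hΩ : ∀ i, IsClarkeRegular 𝓘(ℝ, EU i) (Ω i))
    (hφ_nonneg : ∀ i : Fin n, 0 < (i : ℕ) → ∀ x, 0 ≤ φ i x)
    (hφ_lip : ∀ i : Fin n, 0 < (i : ℕ) →
      LocallyLipschitzInCharts (𝓘(ℝ, E).prod 𝓘(ℝ, EU i)) (φ i))
    (hψ_nonneg : ∀ x, 0 ≤ ψ x)
    (hψ_lip : LocallyLipschitzInCharts 𝓘(ℝ, E) ψ)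
    (u : ∀ i, U i) (q : Fin (n + 1) → Q) (hq : q = stateSeq F q₀ u)
    (hu : u ∈ admissibleControls F q₀ Ω φ ψ)
    (hmin : ∀ c ∈ admissibleControls F q₀ Ω φ ψ, cost F q₀ ℓ L u ≤ cost F q₀ ℓ L c)
    (hφ_reg : ∀ i : Fin n, 0 < (i : ℕ) →
      IsPhiRegularAt (𝓘(ℝ, E).prod 𝓘(ℝ, EU i)) (RiemSqProd gQ (gU i)) (φ i) (q i.castSucc, u i))
    (hψ_reg : IsPhiRegularAt 𝓘(ℝ, E) (RiemSq gQ) ψ (q (Fin.last n))) :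
    ∃ (l₀ κ : ℝ)
      (a : ∀ i : Fin (n + 1), Covector 𝓘(ℝ, E) (q i))
      (b : ∀ i : Fin n, Covector 𝓘(ℝ, EU i) (u i))
      (p : ∀ i : Fin (n + 1), Covector 𝓘(ℝ, E) (q i)),
      (l₀ = 0 ∨ l₀ = 1) ∧ 0 < κ ∧ (l₀ = 0 → κ = 1) ∧
      -- the multipliers `(aᵢ, bᵢ)`, `1 ≤ i ≤ n - 1`, and `aₙ`, with `b₀ = 0`
      (∀ i : Fin n, (i : ℕ) = 0 → b i = 0) ∧
      (∀ i : Fin n, 0 < (i : ℕ) → covectorPair (a i.castSucc) (b i) ∈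
        limitingSubdifferentialReal (𝓘(ℝ, E).prod 𝓘(ℝ, EU i)) (φ i) (q i.castSucc, u i)) ∧
      a (Fin.last n) ∈ limitingSubdifferentialReal 𝓘(ℝ, E) ψ (q (Fin.last n)) ∧
      -- endpoint condition for the costate
      p (Fin.last n) =
        -(κ • a (Fin.last n)) - l₀ • differential 𝓘(ℝ, E) ℓ (q (Fin.last n)) ∧
      -- adjoint equation, `1 ≤ i ≤ n - 1`
      (∀ i : Fin n, 0 < (i : ℕ) → ∀ w : TangentSpace 𝓘(ℝ, E) (q i.castSucc),
        p i.castSucc w =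
          -(l₀ * differential 𝓘(ℝ, E) (fun r => L i (r, u i)) (q i.castSucc) w)
          - κ * a i.castSucc w
          + p i.succ (mfderiv 𝓘(ℝ, E) 𝓘(ℝ, E) (fun r => F i (r, u i)) (q i.castSucc) w)) ∧
      -- stationarity in the control, `0 ≤ i ≤ n - 1`
      (∀ i : Fin n, ∀ v ∈ clarkeTangentCone 𝓘(ℝ, EU i) (Ω i) (u i),
        0 ≤ l₀ * differential 𝓘(ℝ, EU i) (fun c => L i (q i.castSucc, c)) (u i) v
          + κ * b i v
          - p i.succ (mfderiv 𝓘(ℝ, EU i) 𝓘(ℝ, E) (fun c => F i (q i.castSucc, c)) (u i) v)) ∧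
      -- nondegeneracy
      ((∃ i : Fin (n + 1), 0 < (i : ℕ) ∧ a i ≠ 0) ∨ (∃ i : Fin n, b i ≠ 0) ∨ l₀ = 1) := by
  subst hq
  obtain ⟨huΩ, huφ, huψ⟩ := hu
  set q := stateSeq F q₀ u
  set G := trajectoryInChart (E := E) (EU := EU) F q₀ u with hG
  set Φ := constraintInChart (E := E) (EU := EU) φ ψ q u
  have hGu0 : Φ (G (chartPoint EU u)) = 0 := by
    refine (constraintInChart_eq_zero_iff hφ_nonneg hψ_nonneg _ _ _).2 ⟨fun i hi => ?_, ?_⟩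
    · rw [hG, trajectoryInChart_fst_chartPoint, extChartAt_to_inv]
      exact huφ i hi
    · rw [hG, trajectoryInChart_snd_chartPoint, extChartAt_to_inv]
      exact huψ
  obtain ⟨l, κ, cs, zs, A, B, A₀, B₀, hl, hκ, hlκ, hcs, hzs, hA, hB, hAlim, hBlim, hstat, hl0⟩ :=
    exists_multiplier_sequences (contDiffAt_cost q₀ hF hℓ hL u)
      (contDiffAt_trajectoryInChart q₀ hF u)
      (exists_nhds_isClosed_inter_preimage_chart (fun i => (hΩ i).1) u)
      (lipschitzNear_constraintInChart hφ_lip hψ_lip q u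
        (trajectoryInChart_fst_chartPoint q₀ F u) (trajectoryInChart_snd_chartPoint q₀ F u))
      (constraintInChart_nonneg hφ_nonneg hψ_nonneg q u)
      (fun i _ => by
        simpa only [mem_preimage, chartPoint, extChartAt_to_inv] using huΩ i) hGu0 (by
        filter_upwards [eventually_admissible_of_constraintInChart q₀ hF hφ_nonneg hψ_nonneg Ω u]
          with c hc h0
        rw [chartControls_chartPoint]
        exact hmin _ (hc h0))
  have hzs1 : ∀ i, Tendsto (fun k => (zs k).1 i) atTop
      (𝓝 (extChartAt (𝓘(ℝ, E).prod 𝓘(ℝ, EU i)) (q i.castSucc, u i) (q i.castSucc, u i))) := by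
    intro i
    rw [← trajectoryInChart_fst_chartPoint (EU := EU) q₀ F u i]
    exact (((continuous_apply i).comp continuous_fst).tendsto _).comp hzs
  have hzs2 : Tendsto (fun k => (zs k).2) atTop
      (𝓝 (extChartAt 𝓘(ℝ, E) (q (Fin.last n)) (q (Fin.last n)))) := by
    rw [← trajectoryInChart_snd_chartPoint (EU := EU) q₀ F u]
    exact (continuous_snd.tendsto _).comp hzs
  set Ai : (((∀ i, E × EU i) × E) →L[ℝ] ℝ) → ∀ i, E × EU i →L[ℝ] ℝ := fun T i =>
    (T.comp (.inl ℝ _ E)).comp (.single ℝ (fun i => E × EU i) i)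
  set Aψ : (((∀ i, E × EU i) × E) →L[ℝ] ℝ) → E →L[ℝ] ℝ := fun T =>
    T.comp (.inr ℝ (∀ i, E × EU i) E)
  have hAi_lim : ∀ i, Tendsto (fun k => Ai (A k) i) atTop (𝓝 (Ai A₀ i)) := fun i =>
    (hAlim.clm_comp_const _).clm_comp_const _
  have hAψ_lim : Tendsto (fun k => Aψ (A k)) atTop (𝓝 (Aψ A₀)) := hAlim.clm_comp_const _
  have hA1 : ∀ k, IsFrechetSubgradient (fun y : ∀ i, E × EU i =>
      ∑ i, mixedConstraintInChart φ q u i (y i)) (zs k).1 ((A k).comp (.inl ℝ _ E)) := fun k =>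
    IsFrechetSubgradient.fst
      (g := fun z => ψ ((extChartAt 𝓘(ℝ, E) (q (Fin.last n))).symm z)) (hA k)
  have hAi_sub : ∀ k i, IsFrechetSubgradient (mixedConstraintInChart φ q u i) ((zs k).1 i)
      (Ai (A k) i) := fun k i => (hA1 k).pi i
  have hAψ_sub : ∀ k, IsFrechetSubgradient (ψ ∘ (extChartAt 𝓘(ℝ, E) (q (Fin.last n))).symm)
      (zs k).2 (Aψ (A k)) := fun k =>
    IsFrechetSubgradient.snd
      (f := fun y : ∀ i, E × EU i => ∑ i, mixedConstraintInChart φ q u i (y i)) (hA k)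
  have hAi_pos : ∀ i : Fin n, 0 < (i : ℕ) → ∀ k, IsFrechetSubgradient
      (φ i ∘ (extChartAt (𝓘(ℝ, E).prod 𝓘(ℝ, EU i)) (q i.castSucc, u i)).symm) ((zs k).1 i)
      (Ai (A k) i) := fun i hi k => by
    have h1 : mixedConstraintInChart (E := E) (EU := EU) φ q u i =
      φ i ∘ (extChartAt (𝓘(ℝ, E).prod 𝓘(ℝ, EU i)) (q i.castSucc, u i)).symm :=
        funext fun z => if_pos hi
    rw [← h1]
    exact hAi_sub k i
  -- At index `0` the constraint in charts is constant, so all its subgradients vanish; this gives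
  -- `b₀ = 0`.
  have hAi_zero : ∀ i : Fin n, (i : ℕ) = 0 → Ai A₀ i = 0 := fun i hi => by
    have h1 : mixedConstraintInChart (E := E) (EU := EU) φ q u i = fun _ => 0 :=
      funext fun z => if_neg (by omega)
    refine tendsto_nhds_unique (hAi_lim i) (tendsto_const_nhds.congr fun k => ?_)
    have h2 := hAi_sub k i
    rw [h1] at h2
    exact h2.eq_zero_of_const.symm
  set dℓ : E →L[ℝ] ℝ := differential 𝓘(ℝ, E) ℓ (q (Fin.last n))
  set a : Fin (n + 1) → E →L[ℝ] ℝ :=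
    Fin.snoc (α := fun _ => E →L[ℝ] ℝ) (fun i => (Ai A₀ i).comp (.inl ℝ E (EU i))) (Aψ A₀)
  have ha_last : a (Fin.last n) = Aψ A₀ := Fin.snoc_last _ _
  have ha_cast : ∀ i : Fin n, a i.castSucc = (Ai A₀ i).comp (.inl ℝ E (EU i)) := fun i =>
    Fin.snoc_castSucc _ _ _
  set b : ∀ i, EU i →L[ℝ] ℝ := fun i => (Ai A₀ i).comp (.inr ℝ E (EU i)) with hb
  have hpair : ∀ i (x : E) (w : EU i), Ai A₀ i (x, w) = a i.castSucc x + b i w := fun i x w => by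
    have : ((x, w) : E × EU i) = (x, 0) + (0, w) := by simp
    rw [ha_cast, this, map_add]
    rfl
  -- The recursion is run down to index `0`, where it only serves the telescoping sum.
  obtain ⟨p, hpn, hp⟩ := Fin.exists_backward_recursion (-(κ • Aψ A₀) - l • dℓ)
    fun (i : Fin n) (P : E →L[ℝ] ℝ) => -(l • partialFst (L i) (q i.castSucc) (u i)) -
      κ • a i.castSucc + P.comp (partialFst (F i) (q i.castSucc) (u i))
  have hident : ∀ v : ∀ i, EU i, ∑ i : Fin n, (l * partialSnd (L i) (q i.castSucc) (u i) (v i) +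
      κ * b i (v i) - p i.succ (partialSnd (F i) (q i.castSucc) (u i) (v i))) = -B₀ v := by
    intro v
    rw [← adjoint_identity (x := fun j => stateDeriv E EU F q₀ u j v) (dℓ := dℓ)
      (aₙ := Aψ A₀) (a := fun i => a i.castSucc)
      (Lq := fun i => partialFst (L i) (q i.castSucc) (u i))
      (Lu := fun i => partialSnd (L i) (q i.castSucc) (u i))
      (Fu := fun i => partialSnd (F i) (q i.castSucc) (u i))
      (by simp [stateDeriv_zero]) (fun i => stateDeriv_succ q₀ hF u i v) hpn hp]
    have h1 := congrArg (fun T : (∀ i, EU i) →L[ℝ] ℝ => T v) hstat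
    simp only [add_apply, smul_apply, ContinuousLinearMap.comp_apply, smul_eq_mul,
      zero_apply] at h1
    rw [fderiv_cost q₀ hF hℓ hL, fderiv_trajectoryInChart q₀ hF,
      ContinuousLinearMap.apply_pi_prod_eq_sum] at h1
    have h2 : ∀ i, ((A₀.comp (.inl ℝ _ E)).comp (.single ℝ (fun i => E × EU i) i))
        (stateDeriv E EU F q₀ u i.castSucc v, v i) =
        a i.castSucc (stateDeriv E EU F q₀ u i.castSucc v) + b i (v i) := fun i => hpair i _ _
    simp only [h2] at h1
    exact eq_neg_of_add_eq_zero_left h1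
  -- Variations supported in a single control separate the summed identity into one condition for
  -- each index.
  have hident_single : ∀ i (v : EU i), l * partialSnd (L i) (q i.castSucc) (u i) v + κ * b i v -
      p i.succ (partialSnd (F i) (q i.castSucc) (u i) v) = -B₀ (Pi.single i v) := fun i v => by
    rw [← hident, Finset.sum_eq_single i (fun j _ hj => by simp [hj]) (by simp), Pi.single_eq_same]
  refine ⟨l, κ, a, b, p, hl, hκ, hlκ, fun i hi => ?_, fun i hi => ?_, ?_, ?_, fun i hi w => ?_,
    fun i v hv => ?_, ?_⟩
  · simp only [hb, hAi_zero i hi]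
    exact ContinuousLinearMap.zero_comp _
  · have h1 := mem_limitingSubdifferentialReal_of_chart
      (hφ_lip i hi).continuous.continuousAt (hzs1 i) (hAi_lim i) (hAi_pos i hi)
    have h2 : covectorPair (q := q i.castSucc) (u := u i) (a i.castSucc) (b i) = Ai A₀ i :=
      ContinuousLinearMap.ext fun z => (hpair i z.1 z.2).symm
    rw [h2]
    exact h1
  · rw [ha_last]
    exact mem_limitingSubdifferentialReal_of_chart hψ_lip.continuous.continuousAt hzs2 hAψ_lim
      hAψ_sub
  · rw [hpn, ha_last]
    rfl
  · rw [hp i]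
    rfl
  -- Each block of `B₀` is a limiting normal to `Ω i`, hence nonpositive on Clarke tangent vectors.
  · have h2 : (B₀.comp (.single ℝ EU i) : Covector 𝓘(ℝ, EU i) (u i)) ∈
        limitingNormalCone 𝓘(ℝ, EU i) (Ω i) (u i) :=
      mem_limitingNormalCone_of_chart (huΩ i) (((continuous_apply i).tendsto _).comp hcs)
        (hBlim.clm_comp_const _) fun k => (hB k).pi i
    exact (neg_nonneg.2 (hv _ h2)).trans_eq (hident_single i v).symm
  · refine hl.elim (fun h0 => ?_) fun h1 => .inr (.inr h1)
    obtain ⟨hnt, hpos⟩ := hl0 h0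
    by_contra! hcon
    obtain ⟨hcona, hconb, -⟩ := hcon
    -- For `n = 0` the control space is a point, which the abnormal case excludes. So the terminal
    -- index is positive and `hcona` applies to it.
    have hn : n ≠ 0 := by
      rintro rfl
      exact not_subsingleton (∀ i, EU i) inferInstance
    have hψ_ev : ∀ᶠ k in atTop, ¬ 0 < ψ ((extChartAt 𝓘(ℝ, E) (q (Fin.last n))).symm (zs k).2) := by
      rw [← not_frequently]
      intro hfreq
      refine ne_zero_of_isPhiRegularAt hψ_reg (fun x => ?_)
        (exists_norm_mfderiv_extChartAt_le gQ _) hzs2 hAψ_lim hAψ_sub hfreq ?_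
      · rw [RiemSq_zero]
        exact zero_le_one
      · rw [← ha_last]
        exact hcona _ (by simpa using Nat.pos_of_ne_zero hn)
    have hφ_ev : ∀ i, ∀ᶠ k in atTop,
        ¬ 0 < mixedConstraintInChart (E := E) (EU := EU) φ q u i ((zs k).1 i) := by
      intro i
      rw [← not_frequently]
      intro hfreq
      by_cases hi : 0 < (i : ℕ)
      · simp only [mixedConstraintInChart, hi, if_true] at hfreq
        refine ne_zero_of_isPhiRegularAt (hφ_reg i hi) (fun x => ?_)
          (exists_norm_mfderiv_extChartAt_prod_le gQ (gU i) _) (hzs1 i) (hAi_lim i) (hAi_pos i hi)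
          hfreq ?_
        · have : RiemSqProd gQ (gU i) x 0 = 0 := by
            change RiemSq gQ x.1 0 + RiemSq (gU i) x.2 0 = 0
            rw [RiemSq_zero, RiemSq_zero, add_zero]
          rw [this]
          exact zero_le_one
        · refine ContinuousLinearMap.ext fun z => ?_
          rw [hpair i z.1 z.2, hcona i.castSucc hi, hconb i]
          exact add_zero (0 : ℝ)
      · simp [mixedConstraintInChart, hi] at hfreq
    -- If all multipliers vanished, each constraint would eventually be nonpositive at `zs k`,
    -- contradicting the positivity of their sum.
    obtain ⟨k, hk1, hk2⟩ := (hψ_ev.and (eventually_all.2 hφ_ev)).exists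
    refine absurd (hpos k) (not_lt.2 (add_nonpos (Finset.sum_nonpos fun i _ => ?_) ?_))
    · exact not_lt.1 (hk2 i)
    · exact not_lt.1 hk1
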